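/- Identify the $(u,v)$-plane with $\mathbb{C}$ via $u+iv$. For $t\in(0,\pi/2]$ put $s=\arccos\frac{3\cos t-1}{1+\cos t}$, $\tau=\frac12(t+s-\pi)$, and $$\alpha(t)=-\tau,\quad \beta(t)=t-\tau,\quad \gamma(t)=s-\tau,\quad \delta(t)=t+s-\tau .$$ Let $\mathcal{T}^t$ be the open convex quadrilateral with vertices $e^{i\alpha(t)},e^{i\beta(t)},e^{i\gamma(t)},e^{i\delta(t)}$ on the unit circle. Then there are functions $\mathbf f^t:\mathcal T^t\to\mathbb R$, $t\in(0,\pi/2]$, with the following properties. (1) For every $t\in(0,\pi/2]$, $\mathcal T^t$ is an isosceles trapezoid (a rectangle being allowed) whose bases, the sides $[e^{i\beta(t)},e^{i\gamma(t)}]$ and $[e^{i\delta(t)},e^{i\alpha(t)}]$, are parallel to the $u$-axis, and $S^t=\{(u,v,\mathbf f^t(u,v)):(u,v)\in\mathcal T^t\}$ is a Scherk type minimal graph: $\mathbf f=\mathbf f^t$ is smooth on $\mathcal T^t$, satisfies the minimal surface equation $$\mathbf f_{uu}(1+\mathbf f_v^2)-2\mathbf f_u\mathbf f_v\mathbf f_{uv}+\mathbf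 f_{vv}(1+\mathbf f_u^2)=0 ,$$ and, for $z\in\mathcal T^t$, $$\mathbf f^t(z)\to\begin{cases}+\infty, & z\to\zeta\in(e^{i\alpha(t)},e^{i\beta(t)})\cup(e^{i\gamma(t)},e^{i\delta(t)}),\\ -\infty, & z\to\zeta\in(e^{i\beta(t)},e^{i\gamma(t)})\cup(e^{i\delta(t)},e^{i\alpha(t)}),\end{cases}$$ where $(a,b)$ denotes the open segment between $a$ and $b$. Moreover $D_u\mathbf f^t(0,v)=D_{uv}\mathbf f^t(0,v)=0$ at every point $(0,v)\in\mathcal T^t$; in particular $D_u\mathbf f^t(0,0)=D_{uv}\mathbf f^t(0,0)=0$ whenever $0\in\mathcal T^t$. (2) Let $t_\circ=2\arctan\sqrt{\frac12(\sqrt5-1)}$. For every $t\in(t_\circ,\pi/2]$, $\mathcal T^t$ contains $0$ (so $D_u\mathbf f^t(0,0)=D_{uv}\mathbf f^t(0,0)=0$), and the Gaussian curvature $$\mathcal K=\frac{\mathbf f_{uu}\mathbf f_{vv}-\mathbf f_{uv}^2}{(1+\mathbf f_u^2+\mathbf f_v^2)^2}$$ of $S^t$ at its point above $0$ equals $-\kappa^2(t)$,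 where $$\kappa(t)=\frac{\pi(1-r^4)\cos\frac t2}{2\left((1+r^2)\cos\frac t2+2r\sqrt{\cos t}\right)^2},\qquad r=\tan\left(\frac{\pi}{8}\sqrt{\cos t}\,\csc^3\frac t2\,\sin t\right).$$ (3) $\kappa^2(t)\le\frac{\pi^2}{2}$ for every $t\in(t_\circ,\pi/2]$, $\lim_{t\to t_\circ^+}\kappa^2(t)=0$, and $\kappa^2$ is an increasing $C^\infty$ diffeomorphism of $(t_\circ,\pi/2]$ onto $(0,\pi^2/2]$ (one-sided at the included end points). (4) For $t=\pi/2$ the trapezoid is the square $\{|u|<\frac{\sqrt2}{2},\ |v|<\frac{\sqrt2}{2}\}$ and $S^{\pi/2}$ is the classical Scherk graph $$\mathbf f^{\pi/2}(u,v)=\frac{\sqrt2}{\pi}\log\frac{\cos(\pi v/\sqrt2)}{\cos(\pi u/\sqrt2)} .$$ -/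

import Mathlib

open Set Filter Topology
open scoped ContDiff

/-! ## Minimal graphs over planar domains

The plane with coordinates `(u, v)` is identified with `ℂ` through `u + i v`. -/

/-- The partial derivative `D_u f`. -/
noncomputable def Du (f : ℂ → ℝ) (z : ℂ) : ℝ := fderiv ℝ f z 1

/-- The partial derivative `D_v f`. -/
noncomputable def Dv (f : ℂ → ℝ) (z : ℂ) : ℝ := fderiv ℝ f z Complex.I

/-- The non-parametric minimal surface equation for `f` on the set `Q`:
`f_uu (1 + f_v²) - 2 f_u f_v f_uv + f_vv (1 + f_u²) = 0`, for smooth `f`. -/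
structure IsMinimalGraph (f : ℂ → ℝ) (Q : Set ℂ) : Prop where
  smooth : ContDiffOn ℝ ∞ f Q
  equation : ∀ z ∈ Q,
    Du (Du f) z * (1 + Dv f z ^ 2) - 2 * Du f z * Dv f z * Dv (Du f) z
      + Dv (Dv f) z * (1 + Du f z ^ 2) = 0

/-- The Gaussian curvature of the graph of `f` at the point above `z`. -/
noncomputable def gaussCurvature (f : ℂ → ℝ) (z : ℂ) : ℝ :=
  (Du (Du f) z * Dv (Dv f) z - Dv (Du f) z ^ 2) / (1 + Du f z ^ 2 + Dv f z ^ 2) ^ 2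

/-- The open convex quadrilateral with vertices `a, b, c, d`. -/
def quad (a b c d : ℂ) : Set ℂ := interior (convexHull ℝ {a, b, c, d})

/-- The consecutive points `a, b, c, d` are the vertices of a (convex, nondegenerate) isosceles
trapezoid with bases `bc` and `da` parallel to the `u`-axis and legs `ab` and `cd`; rectangles are
included. -/
structure IsHorizontalIsoscelesTrapezoid (a b c d : ℂ) : Prop where
  base_bc : b.im = c.im
  base_da : d.im = a.im
  height_ne : a.im ≠ b.im
  /-- the vectors `b - c` and `a - d` are nonzero and point in the same direction, so that
  `a, b, c, d` go around the trapezoid in this order -/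
  same_direction : 0 < (b.re - c.re) * (a.re - d.re)
  legs : ‖a - b‖ = ‖c - d‖
  diagonals : ‖a - c‖ = ‖b - d‖

/-- A Scherk type minimal graph over the quadrilateral with vertices `a, b, c, d`: it tends to
`+∞` on the open sides `ab`, `cd`, and to `-∞` on the open sides `bc`, `da`. -/
structure IsScherkTypeGraph (a b c d : ℂ) (f : ℂ → ℝ) : Prop where
  minimal : IsMinimalGraph f (quad a b c d)
  tendsto_top : ∀ ζ ∈ openSegment ℝ a b ∪ openSegment ℝ c d,
    Tendsto f (𝓝[quad a b c d] ζ) atTop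
  tendsto_bot : ∀ ζ ∈ openSegment ℝ b c ∪ openSegment ℝ d a,
    Tendsto f (𝓝[quad a b c d] ζ) atBot

/-! ## The family of trapezoids -/

/-- `s = arccos ((3 cos t - 1) / (1 + cos t))`. -/
noncomputable def sAngle (t : ℝ) : ℝ :=
  Real.arccos ((3 * Real.cos t - 1) / (1 + Real.cos t))

/-- `τ = (t + s - π) / 2`. -/
noncomputable def tauAngle (t : ℝ) : ℝ := (t + sAngle t - Real.pi) / 2

noncomputable def alphaAngle (t : ℝ) : ℝ := -tauAngle t
noncomputable def betaAngle (t : ℝ) : ℝ := t - tauAngle t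
noncomputable def gammaAngle (t : ℝ) : ℝ := sAngle t - tauAngle t
noncomputable def deltaAngle (t : ℝ) : ℝ := t + sAngle t - tauAngle t

/-- The point `e^{iθ}` of the unit circle. -/
noncomputable def unitPt (θ : ℝ) : ℂ := Complex.exp (θ * Complex.I)

/-- The open trapezoid with vertices `e^{iα(t)}, e^{iβ(t)}, e^{iγ(t)}, e^{iδ(t)}`. -/
noncomputable def trapezoid (t : ℝ) : Set ℂ :=
  quad (unitPt (alphaAngle t)) (unitPt (betaAngle t)) (unitPt (gammaAngle t))
    (unitPt (deltaAngle t))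

/-! ## The curvature function -/

/-- `t_∘ = 2 arctan √((√5 - 1) / 2)`. -/
noncomputable def tCirc : ℝ := 2 * Real.arctan (Real.sqrt ((Real.sqrt 5 - 1) / 2))

/-- `z_∘ = tan ((π/8) √(cos t) csc³(t/2) sin t)`. -/
noncomputable def zCirc (t : ℝ) : ℝ :=
  Real.tan (Real.pi / 8 * Real.sqrt (Real.cos t) * (1 / Real.sin (t / 2)) ^ 3 * Real.sin t)

/-- `κ(t) = π (1 - r⁴) cos(t/2) / (2 ((1 + r²) cos(t/2) + 2 r √(cos t))²)` with `r = z_∘(t)`. -/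
noncomputable def kappa (t : ℝ) : ℝ :=
  Real.pi * (1 - zCirc t ^ 4) * Real.cos (t / 2) /
    (2 * ((1 + zCirc t ^ 2) * Real.cos (t / 2) + 2 * zCirc t * Real.sqrt (Real.cos t)) ^ 2)

/-- `g` is an increasing (smooth) diffeomorphism of `A` onto `B`. For intervals `A`, `B`,
smoothness at an end point that belongs to the interval is one-sided. -/
def IsIncreasingDiffeo (g : ℝ → ℝ) (A B : Set ℝ) : Prop :=
  StrictMonoOn g A ∧ BijOn g A B ∧ ContDiffOn ℝ ∞ g A ∧
    ∃ h : ℝ → ℝ, InvOn h g A B ∧ ContDiffOn ℝ ∞ h B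

/-- The classical Scherk graph `c log (cos (v/c) / cos (u/c))`, scaled by `c = √2/π` to live over
the square `|u|, |v| < √2/2` inscribed in the unit circle. -/
noncomputable def scherk (z : ℂ) : ℝ :=
  Real.sqrt 2 / Real.pi *
    Real.log (Real.cos (Real.pi * z.im / Real.sqrt 2) / Real.cos (Real.pi * z.re / Real.sqrt 2))

/-! The surfaces are explicit. Put w = a + ib in the strip 0 < b < π/2 and take v = v₀ + m b, height
m (A log|sinh w| + B log|cosh w|) up to a constant, and for u the matching combination of the
arguments of sinh w and cosh w. All three coordinates are harmonic. The holomorphic functions of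
which they are real parts have derivatives m i (A coth w - B tanh w), -m i and m (A coth w + B tanh
w), with squares summing to m² (4AB - 1). So 4AB = 1 makes the parametrization isothermal, hence
minimal. The formal proof checks the equation directly: since v depends on b alone, the change of
variables is triangular, the slopes and second derivatives have closed forms on the strip, and
`isMinimalGraph_modelGraph` becomes a polynomial identity.

On a row b = const the abscissa is increasing in a, and its limits as a → ±∞ are affine in b, so the
image is a trapezoid (`modelMap_bijOn`). Near a leg |a| → ∞ and the height tends to +∞. An interior
point of a base is approached only as w tends to 0 or iπ/2, the zeros of sinh and cosh, and there
the height tends to -∞. The choice of s means sin(s/2) = tan(t/2), which balances legs against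
bases; the inscribed trapezoid is then the model one with A + B = cot(t/2) and A - B = √(cos
t)/sin(t/2).

The axis u = 0 is a = 0, where f_u and f_uv vanish through a factor sinh 2a. At the origin 2b = π/2
- φ with φ = 2 arctan r, which gives the curvature. The origin lies above the lower base exactly
when φ < π/2, and t_∘ is where φ = π/2.

For the curvature function put x = cos t. Only φ², cos φ and √x sin φ enter κ², up to factors smooth
in x, and all of them are smooth in x even at x = 0; this is the purpose of `cosSqrt` and
`sincSqrt`. On [0, √5 - 2] the numerator decreases and the denominator increases, so κ² increases
with t (`deriv_curvatureSq_neg`), and the inverse function theorem gives the diffeomorphism. -/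

/-! ## The entire function `cos √y` -/

/-- The entire function whose value at `x ^ 2` is `cos x`. -/
noncomputable def cosSqrt : ℝ → ℝ :=
  FormalMultilinearSeries.ofScalarsSum (E := ℝ) fun n : ℕ => (-1 : ℝ) ^ n / ((2 * n).factorial : ℝ)

theorem cosSqrt_sq (x : ℝ) : cosSqrt (x ^ 2) = Real.cos x := by
  unfold cosSqrt
  rw [FormalMultilinearSeries.ofScalarsSum_eq_tsum, ← (Real.hasSum_cos x).tsum_eq]
  refine tsum_congr fun n => ?_
  rw [smul_eq_mul, ← pow_mul]
  ring

/-- Consecutive coefficients have ratio 1/((2n+1)(2n+2)) in absolute value, which is at most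
1/(n+1), so the power series has infinite radius. -/
theorem contDiff_cosSqrt : ContDiff ℝ ∞ cosSqrt := by
  set c : ℕ → ℝ := fun n => (-1 : ℝ) ^ n / ((2 * n).factorial : ℝ) with hc
  have hc0 : ∀ n, c n ≠ 0 := fun n => by
    have : ((2 * n).factorial : ℝ) ≠ 0 := by positivity
    simp [hc, this]
  have hr : (FormalMultilinearSeries.ofScalars ℝ c).radius = ⊤ := by
    refine FormalMultilinearSeries.ofScalars_radius_eq_top_of_tendsto ℝ c
      (Eventually.of_forall hc0) ?_
    refine squeeze_zero (fun n => by positivity) (fun n => ?_)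
      (tendsto_one_div_add_atTop_nhds_zero_nat (𝕜 := ℝ))
    have h1 : ((2 * (n + 1)).factorial : ℝ) = (2 * n + 2) * ((2 * n + 1) * (2 * n).factorial) := by
      rw [show 2 * (n + 1) = (2 * n + 1) + 1 by ring, Nat.factorial_succ, Nat.factorial_succ]
      push_cast
      ring
    have h2 : (0 : ℝ) < (2 * n).factorial := by positivity
    simp only [hc, Nat.succ_eq_add_one, norm_div, norm_pow, norm_neg, norm_one, one_pow,
      Real.norm_natCast, h1]
    rw [Real.norm_of_nonneg (by positivity)]
    rw [div_div_div_eq, one_mul, mul_one, div_le_div_iff₀ (by positivity) (by positivity)]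
    have hn : (0 : ℝ) ≤ n := by positivity
    have h3 : ((n : ℝ) + 1) ≤ (2 * n + 2) * (2 * n + 1) := by nlinarith
    nlinarith
  have h := (FormalMultilinearSeries.ofScalars ℝ c).hasFPowerSeriesOnBall (by rw [hr]; simp)
  rw [hr] at h
  have h2 : AnalyticOnNhd ℝ cosSqrt univ := by
    have := h.analyticOnNhd
    rwa [Metric.eball_top] at this
  exact h2.contDiff

/-- The entire function whose value at `x ^ 2` is `sin x / x`. -/
noncomputable def sincSqrt (y : ℝ) : ℝ := -2 * deriv cosSqrt y

theorem contDiff_sincSqrt : ContDiff ℝ ∞ sincSqrt :=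
  contDiff_const.mul ((contDiff_infty_iff_deriv.1 contDiff_cosSqrt).2)

/-- Differentiate the identity `cosSqrt (x ^ 2) = cos x`. -/
theorem mul_sincSqrt_sq (x : ℝ) : x * sincSqrt (x ^ 2) = Real.sin x := by
  have h1 : HasDerivAt cosSqrt (deriv cosSqrt (x ^ 2)) (x ^ 2) :=
    ((contDiff_cosSqrt.differentiable (by simp)) _).hasDerivAt
  have h2 : HasDerivAt (fun x : ℝ => x ^ 2) (2 * x) x := by simpa using hasDerivAt_pow 2 x
  have h3 := HasDerivAt.comp (h := fun x : ℝ => x ^ 2) x h1 h2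
  have h4 : cosSqrt ∘ (fun x : ℝ => x ^ 2) = Real.cos := funext cosSqrt_sq
  rw [h4] at h3
  have h5 := h3.unique (Real.hasDerivAt_cos x)
  unfold sincSqrt
  linarith

/-! ## The curvature as a function of `cos t` -/

/-- The square of the angle `2 arctan z_∘`, as a function of `x = cos t`. -/
noncomputable def angleSq (x : ℝ) : ℝ := Real.pi ^ 2 / 2 * (x * (1 + x)) / (1 - x) ^ 2

/-- The factor `1 + √(2x / (1 + x)) sin √(angleSq x)` in a form which is smooth at `x = 0`. -/
noncomputable def slopeFactor (x : ℝ) : ℝ :=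
  1 + Real.pi * x / (1 - x) * sincSqrt (angleSq x)

/-- The squared curvature as a function of `x = cos t`. -/
noncomputable def curvatureSq (x : ℝ) : ℝ :=
  Real.pi ^ 2 / 2 * cosSqrt (angleSq x) ^ 2 / ((1 + x) * slopeFactor x ^ 4)

theorem angleSq_nonneg {x : ℝ} (hx : 0 ≤ x) : 0 ≤ angleSq x := by
  unfold angleSq; positivity

theorem angleSq_monotoneOn : MonotoneOn angleSq (Ico 0 1) := by
  intro x hx y hy hxy
  unfold angleSq
  have h1 : 0 < 1 - y := by linarith [hy.2]
  have h0 := hx.1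
  have h2 := hy.1
  gcongr

theorem cosSqrt_angleSq {x : ℝ} (hx : 0 ≤ x) :
    cosSqrt (angleSq x) = Real.cos (Real.sqrt (angleSq x)) := by
  rw [← cosSqrt_sq, Real.sq_sqrt (angleSq_nonneg hx)]

/-- The product of the two square roots √(2x/(1+x)) and √(angleSq x) is rational in x, so the roots
disappear once the sine is written as angle times an even function. -/
theorem slopeFactor_eq {x : ℝ} (hx : x ∈ Ico (0 : ℝ) 1) :
    slopeFactor x = 1 + Real.sqrt (2 * x / (1 + x)) * Real.sin (Real.sqrt (angleSq x)) := by
  obtain ⟨h0, h1⟩ := hx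
  have h1' : 0 < 1 - x := by linarith
  have h2 : Real.sqrt (2 * x / (1 + x)) * Real.sqrt (angleSq x) = Real.pi * x / (1 - x) := by
    rw [← Real.sqrt_mul (by positivity)]
    have : 2 * x / (1 + x) * angleSq x = (Real.pi * x / (1 - x)) ^ 2 := by
      unfold angleSq; field_simp
    rw [this, Real.sqrt_sq (by have := Real.pi_pos; positivity)]
  rw [← mul_sincSqrt_sq, Real.sq_sqrt (angleSq_nonneg h0), ← mul_assoc, h2]
  rfl

theorem sqrt_five_bounds : 2 < Real.sqrt 5 ∧ Real.sqrt 5 < 5 / 2 :=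
  ⟨Real.lt_sqrt_of_sq_lt (by norm_num), by
    rw [Real.sqrt_lt' (by norm_num)]; norm_num⟩

/-- The condition reduces to 2x(1 + x) = (1 - x)², that is x² + 4x - 1 = 0, whose positive root is
√5 - 2. -/
theorem angleSq_sqrt_five : angleSq (Real.sqrt 5 - 2) = (Real.pi / 2) ^ 2 := by
  have h := sqrt_five_bounds
  have h5 : Real.sqrt 5 ^ 2 = 5 := Real.sq_sqrt (by norm_num)
  have h1 : (1 - (Real.sqrt 5 - 2)) ≠ 0 := by linarith
  unfold angleSq
  rw [div_eq_iff (by positivity)]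
  linear_combination (Real.pi ^ 2 / 4) * h5

theorem sqrt_angleSq_le {x : ℝ} (hx : x ∈ Icc 0 (Real.sqrt 5 - 2)) :
    Real.sqrt (angleSq x) ≤ Real.pi / 2 := by
  have h := sqrt_five_bounds
  have h1 := angleSq_monotoneOn ⟨hx.1, by linarith [hx.2]⟩ ⟨by linarith, by linarith⟩ hx.2
  rw [angleSq_sqrt_five] at h1
  rw [Real.sqrt_le_left (by have := Real.pi_pos; positivity)]
  exact h1

theorem sqrt_angleSq_lt {x : ℝ} (hx : x ∈ Ico 0 (Real.sqrt 5 - 2)) :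
    Real.sqrt (angleSq x) < Real.pi / 2 := by
  have h := sqrt_five_bounds
  have hpi := Real.pi_pos
  have h5 : Real.sqrt 5 ^ 2 = 5 := Real.sq_sqrt (by norm_num)
  have h1 : 0 < 1 - x := by linarith [hx.2]
  rw [Real.sqrt_lt' (by positivity)]
  unfold angleSq
  rw [div_lt_iff₀ (by positivity)]
  have h2 : 2 * (x * (1 + x)) < (1 - x) ^ 2 := by nlinarith [hx.1, hx.2]
  nlinarith [mul_pos hpi hpi]

theorem cosSqrt_angleSq_sq_antitoneOn :
    AntitoneOn (fun x => cosSqrt (angleSq x) ^ 2) (Icc 0 (Real.sqrt 5 - 2)) := by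
  have h := sqrt_five_bounds
  intro x hx y hy hxy
  have h1 := Real.sqrt_le_sqrt (angleSq_monotoneOn ⟨hx.1, by linarith [hx.2]⟩
    ⟨hy.1, by linarith [hy.2]⟩ hxy)
  have h2 := sqrt_angleSq_le hy
  have h3 := Real.sqrt_nonneg (angleSq x)
  simp only [cosSqrt_angleSq hx.1, cosSqrt_angleSq hy.1]
  have h4 : 0 ≤ Real.cos (Real.sqrt (angleSq y)) :=
    Real.cos_nonneg_of_neg_pi_div_two_le_of_le (by linarith [Real.pi_pos]) h2
  have h5 := Real.cos_le_cos_of_nonneg_of_le_pi h3 (by linarith [Real.pi_pos]) h1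
  gcongr

theorem one_le_slopeFactor {x : ℝ} (hx : x ∈ Icc 0 (Real.sqrt 5 - 2)) : 1 ≤ slopeFactor x := by
  have h := sqrt_five_bounds
  rw [slopeFactor_eq ⟨hx.1, by linarith [hx.2]⟩]
  have := Real.sin_nonneg_of_nonneg_of_le_pi (Real.sqrt_nonneg (angleSq x))
    (by linarith [Real.pi_pos, sqrt_angleSq_le hx])
  have := Real.sqrt_nonneg (2 * x / (1 + x))
  have : 0 ≤ Real.sqrt (2 * x / (1 + x)) * Real.sin (Real.sqrt (angleSq x)) := by positivity
  linarith

theorem slopeFactor_monotoneOn : MonotoneOn slopeFactor (Icc 0 (Real.sqrt 5 - 2)) := by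
  have h := sqrt_five_bounds
  intro x hx y hy hxy
  have hx' : x ∈ Ico (0 : ℝ) 1 := ⟨hx.1, by linarith [hx.2]⟩
  have hy' : y ∈ Ico (0 : ℝ) 1 := ⟨hy.1, by linarith [hy.2]⟩
  rw [slopeFactor_eq hx', slopeFactor_eq hy']
  have h1 := Real.sqrt_le_sqrt (angleSq_monotoneOn hx' hy' hxy)
  have h2 := sqrt_angleSq_le hy
  have h3 := Real.sqrt_nonneg (angleSq x)
  have h4 : Real.sin (Real.sqrt (angleSq x)) ≤ Real.sin (Real.sqrt (angleSq y)) :=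
    Real.sin_le_sin_of_le_of_le_pi_div_two (by linarith [Real.pi_pos]) h2 h1
  have h5 : 2 * x / (1 + x) ≤ 2 * y / (1 + y) := by
    have := hx.1
    have := hy.1
    rw [div_le_div_iff₀ (by positivity) (by positivity)]
    nlinarith
  have h6 := Real.sin_nonneg_of_nonneg_of_le_pi (Real.sqrt_nonneg (angleSq x))
    (by linarith [Real.pi_pos, sqrt_angleSq_le hx])
  gcongr

theorem contDiffAt_angleSq {x : ℝ} (hx : x < 1) : ContDiffAt ℝ ∞ angleSq x := by
  have : (1 - x) ^ 2 ≠ 0 := by have : 0 < 1 - x := by linarith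
                               positivity
  unfold angleSq
  fun_prop (disch := assumption)

theorem contDiffAt_slopeFactor {x : ℝ} (hx : x < 1) : ContDiffAt ℝ ∞ slopeFactor x := by
  have h1 : 1 - x ≠ 0 := by linarith
  have h2 : ContDiffAt ℝ ∞ (fun x => sincSqrt (angleSq x)) x :=
    (contDiff_sincSqrt.contDiffAt).comp x (contDiffAt_angleSq hx)
  unfold slopeFactor
  fun_prop (disch := assumption)

theorem contDiffAt_cosSqrt_angleSq {x : ℝ} (hx : x < 1) :
    ContDiffAt ℝ ∞ (fun x => cosSqrt (angleSq x)) x :=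
  (contDiff_cosSqrt.contDiffAt).comp x (contDiffAt_angleSq hx)

theorem contDiffAt_curvatureSq {x : ℝ} (hx : x ∈ Icc 0 (Real.sqrt 5 - 2)) :
    ContDiffAt ℝ ∞ curvatureSq x := by
  have h := sqrt_five_bounds
  have h1 : x < 1 := by linarith [hx.2]
  have h2 := one_le_slopeFactor hx
  have h3 : (1 + x) * slopeFactor x ^ 4 ≠ 0 := by
    have := hx.1
    positivity
  exact ((contDiffAt_const.mul ((contDiffAt_cosSqrt_angleSq h1).pow 2))).div
    ((contDiffAt_const.add contDiffAt_id).mul ((contDiffAt_slopeFactor h1).pow 4)) h3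

/-- The monotonicity lemmas supply only weak signs; strictness comes from the factor 1 + x in the
denominator. It needs a nonzero cosine, which is why the right end point is excluded. -/
theorem deriv_curvatureSq_neg {x : ℝ} (hx : x ∈ Ico 0 (Real.sqrt 5 - 2)) :
    deriv curvatureSq x < 0 := by
  have h := sqrt_five_bounds
  have hx' : x ∈ Icc 0 (Real.sqrt 5 - 2) := Ico_subset_Icc_self hx
  have h1 : x < 1 := by linarith [hx.2]
  -- Monotonicity is known only on the closed interval, so at x = 0 the sign of the derivative is
  -- read from the derivative within that interval.
  have hu : UniqueDiffWithinAt ℝ (Icc 0 (Real.sqrt 5 - 2)) x :=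
    uniqueDiffOn_Icc (by linarith) x hx'
  have hn : DifferentiableAt ℝ (fun x => cosSqrt (angleSq x) ^ 2) x :=
    ((contDiffAt_cosSqrt_angleSq h1).pow 2).differentiableAt (by simp)
  have hq : DifferentiableAt ℝ slopeFactor x :=
    (contDiffAt_slopeFactor h1).differentiableAt (by simp)
  have hn' : deriv (fun x => cosSqrt (angleSq x) ^ 2) x ≤ 0 := by
    rw [← hn.derivWithin hu]
    exact cosSqrt_angleSq_sq_antitoneOn.derivWithin_nonpos
  have hq' : 0 ≤ deriv slopeFactor x := by
    rw [← hq.derivWithin hu]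
    exact slopeFactor_monotoneOn.derivWithin_nonneg
  have hq1 := one_le_slopeFactor hx'
  have hn1 : 0 < cosSqrt (angleSq x) := by
    rw [cosSqrt_angleSq hx.1]
    exact Real.cos_pos_of_mem_Ioo
      ⟨by linarith [Real.pi_pos, Real.sqrt_nonneg (angleSq x)], sqrt_angleSq_lt hx⟩
  have hx0 := hx.1
  have hd := ((hn.hasDerivAt.const_mul (Real.pi ^ 2 / 2)).div
    (((hasDerivAt_id x).const_add 1).mul (hq.hasDerivAt.pow 4))
    (by simp only [id, Pi.mul_apply, Pi.pow_apply]; positivity))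
  have hd' : deriv curvatureSq x = _ := hd.deriv
  rw [hd']
  simp only [id, Pi.mul_apply, Pi.pow_apply]
  apply div_neg_of_neg_of_pos _ (by positivity)
  have e1 : Real.pi ^ 2 / 2 * deriv (fun x => cosSqrt (angleSq x) ^ 2) x *
      ((1 + x) * slopeFactor x ^ 4) ≤ 0 :=
    mul_nonpos_of_nonpos_of_nonneg (mul_nonpos_of_nonneg_of_nonpos (by positivity) hn')
      (by positivity)
  have hpi := Real.pi_pos
  have e2 : 0 < Real.pi ^ 2 / 2 * cosSqrt (angleSq x) ^ 2 * (1 * slopeFactor x ^ 4 +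
      (1 + x) * (((4 : ℕ) : ℝ) * slopeFactor x ^ (4 - 1) * deriv slopeFactor x)) := by
    positivity
  linarith

theorem curvatureSq_zero : curvatureSq 0 = Real.pi ^ 2 / 2 := by
  have : cosSqrt 0 = 1 := by simpa using cosSqrt_sq 0
  simp [curvatureSq, slopeFactor, angleSq, this]

theorem curvatureSq_sqrt_five : curvatureSq (Real.sqrt 5 - 2) = 0 := by
  have : cosSqrt (angleSq (Real.sqrt 5 - 2)) = 0 := by
    rw [angleSq_sqrt_five, cosSqrt_sq, Real.cos_pi_div_two]
  simp [curvatureSq, this]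

/-! ## Inverting a smooth increasing function on a half-open interval -/

/-- A function which is smooth at each point of `[a, b]`, with positive derivative on `(a, b]`, is an
increasing diffeomorphism of `(a, b]` onto `(g a, g b]`. -/
theorem isIncreasingDiffeo_Ioc {g : ℝ → ℝ} {a b : ℝ} (hab : a < b)
    (hg : ∀ x ∈ Icc a b, ContDiffAt ℝ ∞ g x) (hd : ∀ x ∈ Ioc a b, 0 < deriv g x) :
    IsIncreasingDiffeo g (Ioc a b) (Ioc (g a) (g b)) := by
  have hcont : ContinuousOn g (Icc a b) := fun x hx => (hg x hx).continuousAt.continuousWithinAt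
  have hmono : StrictMonoOn g (Icc a b) := by
    refine strictMonoOn_of_deriv_pos (convex_Icc _ _) hcont fun x hx => ?_
    rw [interior_Icc] at hx
    exact hd x (Ioo_subset_Ioc_self hx)
  have hsub : Ioc a b ⊆ Icc a b := Ioc_subset_Icc_self
  have hmaps : MapsTo g (Ioc a b) (Ioc (g a) (g b)) := fun x hx =>
    ⟨hmono (left_mem_Icc.2 hab.le) (hsub hx) hx.1,
      hmono.monotoneOn (hsub hx) (right_mem_Icc.2 hab.le) hx.2⟩
  have hsurj : SurjOn g (Ioc a b) (Ioc (g a) (g b)) := intermediate_value_Ioc hab.le hcont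
  have hbij : BijOn g (Ioc a b) (Ioc (g a) (g b)) := ⟨hmaps, (hmono.mono hsub).injOn, hsurj⟩
  refine ⟨hmono.mono hsub, hbij, fun x hx => (hg x (hsub hx)).contDiffWithinAt,
    Function.invFunOn g (Ioc a b), hbij.invOn_invFunOn, fun y hy => ?_⟩
  set h := Function.invFunOn g (Ioc a b) with hh
  have hinv : InvOn h g (Ioc a b) (Ioc (g a) (g b)) := hbij.invOn_invFunOn
  have hmapsh : MapsTo h (Ioc (g a) (g b)) (Ioc a b) := hsurj.mapsTo_invFunOn
  -- Continuity of the inverse follows from the order alone, before any inverse function theorem.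
  have hconth : ContinuousWithinAt h (Ioc (g a) (g b)) y := by
    have hopen : Tendsto h (𝓝[Ioc (g a) (g b)] y) (𝓝 (h y)) := by
      rw [tendsto_order]
      have hyA := hmapsh hy
      constructor
      · intro x hx
        -- The given x may lie below a; the midpoint replaces it by a comparison point inside the
        -- interval.
        have hx1 : max x ((a + h y) / 2) < h y := max_lt hx (by linarith [hyA.1])
        have hxA : max x ((a + h y) / 2) ∈ Ioc a b :=
          ⟨lt_max_of_lt_right (by linarith [hyA.1]), hx1.le.trans hyA.2⟩
        have hgx : g (max x ((a + h y) / 2)) < y := by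
          have := hmono (hsub hxA) (hsub hyA) hx1
          rwa [hinv.2 hy] at this
        filter_upwards [mem_nhdsWithin_of_mem_nhds (Ioi_mem_nhds hgx), self_mem_nhdsWithin]
          with z hz hzB
        by_contra hcon
        have := hmono.monotoneOn (hsub (hmapsh hzB)) (hsub hxA)
          ((not_lt.1 hcon).trans (le_max_left _ _))
        rw [hinv.2 hzB] at this
        exact absurd hz (not_lt.2 this)
      · intro x hx
        by_cases hxb : b < x
        · filter_upwards [self_mem_nhdsWithin] with z hzB
          exact (hmapsh hzB).2.trans_lt hxb
        have hxA : x ∈ Ioc a b := ⟨hyA.1.trans hx, not_lt.1 hxb⟩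
        have hgx : y < g x := by
          have := hmono (hsub hyA) (hsub hxA) hx
          rwa [hinv.2 hy] at this
        filter_upwards [mem_nhdsWithin_of_mem_nhds (Iio_mem_nhds hgx), self_mem_nhdsWithin]
          with z hz hzB
        by_contra hcon
        have := hmono.monotoneOn (hsub hxA) (hsub (hmapsh hzB)) (not_lt.1 hcon)
        rw [hinv.2 hzB] at this
        exact absurd hz (not_lt.2 this)
    exact hopen
  have hx0 := hmapsh hy
  have hgy : g (h y) = y := hinv.2 hy
  have hder : HasDerivAt g (deriv g (h y)) (h y) :=
    ((hg _ (hsub hx0)).differentiableAt (by simp)).hasDerivAt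
  have hf' := hder.hasFDerivAt_equiv (hd _ hx0).ne'
  have hloc := (hg _ (hsub hx0)).to_localInverse hf' (by simp)
  rw [hgy] at hloc
  have hleft := ((hg _ (hsub hx0)).hasStrictFDerivAt' hf' (by simp)).eventually_left_inverse
  refine hloc.contDiffWithinAt.congr_of_eventuallyEq_of_mem ?_ hy
  -- Continuity brings h z close to h y, where the smooth local inverse undoes g; hence the two
  -- inverses agree near y inside the interval.
  filter_upwards [hconth.eventually hleft, self_mem_nhdsWithin] with z hz hzB
  rw [hinv.2 hzB] at hz
  exact hz.symm

/-! ## The threshold `t_∘` and the function `κ` -/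

theorem cos_tCirc : Real.cos tCirc = Real.sqrt 5 - 2 := by
  have h := sqrt_five_bounds
  have h5 : Real.sqrt 5 ^ 2 = 5 := Real.sq_sqrt (by norm_num)
  unfold tCirc
  rw [Real.cos_two_mul, Real.cos_sq_arctan, Real.sq_sqrt (by linarith)]
  rw [show 1 + (Real.sqrt 5 - 1) / 2 = (1 + Real.sqrt 5) / 2 by ring]
  field_simp
  linear_combination -h5

theorem tCirc_mem : tCirc ∈ Ioo 0 (Real.pi / 2) := by
  have h := sqrt_five_bounds
  have h0 : 0 < tCirc := by
    unfold tCirc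
    have : 0 < Real.arctan (Real.sqrt ((Real.sqrt 5 - 1) / 2)) :=
      Real.arctan_pos.2 (Real.sqrt_pos.2 (by linarith))
    linarith
  have hpi : tCirc < Real.pi := by
    unfold tCirc
    linarith [Real.arctan_lt_pi_div_two (Real.sqrt ((Real.sqrt 5 - 1) / 2))]
  refine ⟨h0, ?_⟩
  by_contra hcon
  have := Real.cos_nonpos_of_pi_div_two_le_of_le (not_lt.1 hcon)
    (by linarith : tCirc ≤ Real.pi + Real.pi / 2)
  rw [cos_tCirc] at this
  linarith

theorem cos_mem_Icc {t : ℝ} (ht : t ∈ Icc tCirc (Real.pi / 2)) :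
    Real.cos t ∈ Icc 0 (Real.sqrt 5 - 2) := by
  have h0 := tCirc_mem
  refine ⟨Real.cos_nonneg_of_neg_pi_div_two_le_of_le (by linarith [h0.1, ht.1, Real.pi_pos]) ht.2,
    ?_⟩
  rw [← cos_tCirc]
  exact Real.cos_le_cos_of_nonneg_of_le_pi h0.1.le (by linarith [ht.2, Real.pi_pos]) ht.1

theorem cos_mem_Ico {t : ℝ} (ht : t ∈ Ioc tCirc (Real.pi / 2)) :
    Real.cos t ∈ Ico 0 (Real.sqrt 5 - 2) := by
  have h0 := tCirc_mem
  refine ⟨(cos_mem_Icc (Ioc_subset_Icc_self ht)).1, ?_⟩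
  rw [← cos_tCirc]
  exact Real.cos_lt_cos_of_nonneg_of_le_pi h0.1.le (by linarith [ht.2, Real.pi_pos]) ht.1

theorem sin_half_pos {t : ℝ} (ht : t ∈ Ioc 0 (Real.pi / 2)) : 0 < Real.sin (t / 2) :=
  Real.sin_pos_of_pos_of_lt_pi (by linarith [ht.1]) (by linarith [ht.2, Real.pi_pos])

theorem cos_half_pos {t : ℝ} (ht : t ∈ Ioc 0 (Real.pi / 2)) : 0 < Real.cos (t / 2) :=
  Real.cos_pos_of_mem_Ioo ⟨by linarith [ht.1, Real.pi_pos], by linarith [ht.2, Real.pi_pos]⟩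

theorem cos_nonneg_of_mem {t : ℝ} (ht : t ∈ Ioc 0 (Real.pi / 2)) : 0 ≤ Real.cos t :=
  Real.cos_nonneg_of_neg_pi_div_two_le_of_le (by linarith [ht.1, Real.pi_pos]) ht.2

theorem cos_half_sq (t : ℝ) : Real.cos (t / 2) ^ 2 = (1 + Real.cos t) / 2 := by
  have := Real.cos_two_mul (t / 2)
  rw [mul_div_cancel₀ t two_ne_zero] at this
  linarith

theorem sin_half_sq (t : ℝ) : Real.sin (t / 2) ^ 2 = (1 - Real.cos t) / 2 := by
  have := Real.sin_sq_add_cos_sq (t / 2)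
  rw [cos_half_sq] at this
  linarith

theorem Ioc_tCirc_subset : Ioc tCirc (Real.pi / 2) ⊆ Ioc 0 (Real.pi / 2) :=
  Ioc_subset_Ioc_left tCirc_mem.1.le

/-- The angle `2 arctan z_∘(t)`. -/
noncomputable def phiAngle (t : ℝ) : ℝ :=
  Real.pi / 2 * Real.sqrt (Real.cos t) * Real.cos (t / 2) / Real.sin (t / 2) ^ 2

theorem zCirc_eq {t : ℝ} (ht : t ∈ Ioc 0 (Real.pi / 2)) :
    zCirc t = Real.tan (phiAngle t / 2) := by
  unfold zCirc phiAngle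
  congr 1
  have h := (sin_half_pos ht).ne'
  have h2 : Real.sin t = 2 * Real.sin (t / 2) * Real.cos (t / 2) := by
    rw [← Real.sin_two_mul, mul_div_cancel₀ t two_ne_zero]
  rw [h2]
  field_simp
  ring

theorem phiAngle_nonneg {t : ℝ} (ht : t ∈ Ioc 0 (Real.pi / 2)) : 0 ≤ phiAngle t := by
  have := cos_half_pos ht
  have := Real.pi_pos
  unfold phiAngle
  positivity

theorem phiAngle_eq_sqrt {t : ℝ} (ht : t ∈ Ioc 0 (Real.pi / 2)) :
    phiAngle t = Real.sqrt (angleSq (Real.cos t)) := by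
  symm
  rw [Real.sqrt_eq_iff_mul_self_eq (angleSq_nonneg (cos_nonneg_of_mem ht)) (phiAngle_nonneg ht)]
  have h := sin_half_pos ht
  have h1 := sin_half_sq t
  have h2 : 0 < 1 - Real.cos t := by nlinarith
  unfold phiAngle angleSq
  have h3 := Real.sq_sqrt (cos_nonneg_of_mem ht)
  rw [h1, div_mul_div_comm, show ∀ p a c : ℝ, p / 2 * a * c * (p / 2 * a * c) =
    p ^ 2 / 4 * a ^ 2 * c ^ 2 by intros; ring, h3, cos_half_sq]
  field_simp
  ring

theorem phiAngle_lt {t : ℝ} (ht : t ∈ Ioc tCirc (Real.pi / 2)) : phiAngle t < Real.pi / 2 := by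
  rw [phiAngle_eq_sqrt (Ioc_tCirc_subset ht)]
  exact sqrt_angleSq_lt (cos_mem_Ico ht)

/-- Half-angle substitution r = tan(φ/2): then 1 - r⁴ = cos φ / cos⁴(φ/2), and the base of the
squared factor acquires the denominator cos²(φ/2), so these powers cancel. -/
theorem kappa_eq {t : ℝ} (ht : t ∈ Ioc tCirc (Real.pi / 2)) :
    kappa t = Real.pi / 2 * Real.cos (t / 2) * Real.cos (phiAngle t) /
      (Real.cos (t / 2) + Real.sqrt (Real.cos t) * Real.sin (phiAngle t)) ^ 2 := by
  have ht' := Ioc_tCirc_subset ht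
  have h0 := phiAngle_nonneg ht'
  have h1 := phiAngle_lt ht
  have hc : 0 < Real.cos (phiAngle t / 2) :=
    Real.cos_pos_of_mem_Ioo ⟨by linarith [Real.pi_pos], by linarith [Real.pi_pos]⟩
  have hs : 0 ≤ Real.sin (phiAngle t / 2) :=
    Real.sin_nonneg_of_nonneg_of_le_pi (by linarith) (by linarith [Real.pi_pos])
  have hch := cos_half_pos ht'
  have hx := Real.sqrt_nonneg (Real.cos t)
  have e1 : Real.cos (phiAngle t) = Real.cos (phiAngle t / 2) ^ 2 - Real.sin (phiAngle t / 2) ^ 2 := by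
    rw [← Real.cos_two_mul', mul_div_cancel₀ _ two_ne_zero]
  have e2 : Real.sin (phiAngle t) = 2 * Real.sin (phiAngle t / 2) * Real.cos (phiAngle t / 2) := by
    rw [← Real.sin_two_mul, mul_div_cancel₀ _ two_ne_zero]
  have e3 := Real.sin_sq_add_cos_sq (phiAngle t / 2)
  unfold kappa
  rw [zCirc_eq ht', Real.tan_eq_sin_div_cos, e1, e2]
  set C := Real.cos (phiAngle t / 2)
  set S := Real.sin (phiAngle t / 2)
  set ch := Real.cos (t / 2)
  set x := Real.sqrt (Real.cos t)
  have d1 : (1 + (S / C) ^ 2) * ch + 2 * (S / C) * x = (ch + x * (2 * S * C)) / C ^ 2 := by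
    field_simp
    linear_combination ch * e3
  have d2 : 1 - (S / C) ^ 4 = (C ^ 2 - S ^ 2) / C ^ 4 := by
    field_simp
    linear_combination (C ^ 2 - S ^ 2) * e3
  rw [d1, d2]
  have : ch + x * (2 * S * C) ≠ 0 := by positivity
  field_simp

theorem kappa_sq_eq {t : ℝ} (ht : t ∈ Ioc tCirc (Real.pi / 2)) :
    kappa t ^ 2 = curvatureSq (Real.cos t) := by
  have ht' := Ioc_tCirc_subset ht
  have h5 := sqrt_five_bounds
  have hx := cos_mem_Ico ht
  have hch := cos_half_pos ht'
  have hs := Real.sqrt_nonneg (Real.cos t)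
  have h1 : Real.sqrt (2 * Real.cos t / (1 + Real.cos t)) =
      Real.sqrt (Real.cos t) / Real.cos (t / 2) := by
    rw [Real.sqrt_eq_iff_mul_self_eq (by have := hx.1; positivity) (by positivity),
      div_mul_div_comm, Real.mul_self_sqrt hx.1, ← sq, cos_half_sq]
    have := hx.1
    field_simp
  have hsin : 0 ≤ Real.sin (phiAngle t) :=
    Real.sin_nonneg_of_nonneg_of_le_pi (phiAngle_nonneg ht')
      (by linarith [phiAngle_lt ht, Real.pi_pos])
  unfold curvatureSq
  rw [kappa_eq ht, slopeFactor_eq ⟨hx.1, by linarith [hx.2]⟩, cosSqrt_angleSq hx.1,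
    ← phiAngle_eq_sqrt ht', h1,
    show 1 + Real.cos t = 2 * Real.cos (t / 2) ^ 2 by rw [cos_half_sq]; ring]
  have h2 : Real.cos (t / 2) + Real.sqrt (Real.cos t) * Real.sin (phiAngle t) ≠ 0 := by positivity
  field_simp

/-- The composite `curvatureSq ∘ cos` is smooth in a full neighbourhood of every point of the closed
interval, where κ² itself contains √(cos t). The diffeomorphism is obtained for the composite and
transferred to κ² on the half-open interval. -/
theorem isIncreasingDiffeo_kappa_sq :
    IsIncreasingDiffeo (fun t => kappa t ^ 2) (Ioc tCirc (Real.pi / 2))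
      (Ioc 0 (Real.pi ^ 2 / 2)) := by
  have h := tCirc_mem
  have h1 : IsIncreasingDiffeo (fun t => curvatureSq (Real.cos t)) (Ioc tCirc (Real.pi / 2))
      (Ioc (curvatureSq (Real.cos tCirc)) (curvatureSq (Real.cos (Real.pi / 2)))) := by
    refine isIncreasingDiffeo_Ioc h.2
      (fun t ht => (contDiffAt_curvatureSq (cos_mem_Icc ht)).comp t Real.contDiff_cos.contDiffAt)
      fun t ht => ?_
    have hd : HasDerivAt curvatureSq (deriv curvatureSq (Real.cos t)) (Real.cos t) :=
      ((contDiffAt_curvatureSq (cos_mem_Icc (Ioc_subset_Icc_self ht))).differentiableAt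
        (by simp)).hasDerivAt
    have hd' : deriv (fun t => curvatureSq (Real.cos t)) t = _ :=
      (hd.comp t (Real.hasDerivAt_cos t)).deriv
    rw [hd']
    have := deriv_curvatureSq_neg (cos_mem_Ico ht)
    have := Real.sin_pos_of_pos_of_lt_pi (h.1.trans ht.1) (by linarith [ht.2, Real.pi_pos])
    nlinarith
  rw [cos_tCirc, curvatureSq_sqrt_five, Real.cos_pi_div_two, curvatureSq_zero] at h1
  have heq : EqOn (fun t => curvatureSq (Real.cos t)) (fun t => kappa t ^ 2)
      (Ioc tCirc (Real.pi / 2)) := fun t ht => (kappa_sq_eq ht).symm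
  obtain ⟨hm, hb, hs, g, hg, hgs⟩ := h1
  exact ⟨hm.congr heq, hb.congr heq, hs.congr fun t ht => (heq ht).symm, g,
    ⟨fun t ht => by rw [← heq ht]; exact hg.1 ht, fun y hy => by
      rw [← heq (hg.1.mapsTo hb.surjOn hy)]; exact hg.2 hy⟩, hgs⟩

theorem tendsto_kappa_sq : Tendsto (fun t => kappa t ^ 2) (𝓝[>] tCirc) (𝓝 0) := by
  have h := tCirc_mem
  have h1 : ContinuousAt (fun t => curvatureSq (Real.cos t)) tCirc :=
    ((contDiffAt_curvatureSq (cos_mem_Icc ⟨le_rfl, h.2.le⟩)).comp tCirc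
      Real.contDiff_cos.contDiffAt).continuousAt
  have h2 : Tendsto (fun t => curvatureSq (Real.cos t)) (𝓝 tCirc) (𝓝 0) := by
    have := h1.tendsto
    rwa [cos_tCirc, curvatureSq_sqrt_five] at this
  refine (h2.mono_left nhdsWithin_le_nhds).congr' ?_
  filter_upwards [Ioc_mem_nhdsGT h.2] with t ht
  exact (kappa_sq_eq ht).symm

/-! ## Partial derivatives -/

theorem Du_eq_of_hasDerivAt {g : ℂ → ℝ} {z : ℂ} {d : ℝ} (hg : DifferentiableAt ℝ g z)
    (h : HasDerivAt (fun x : ℝ => g ⟨x, z.im⟩) d z.re) : Du g z = d := by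
  have hline : HasDerivAt (fun x : ℝ => (⟨x, z.im⟩ : ℂ)) 1 z.re := by
    have := (Complex.ofRealCLM.hasDerivAt (x := z.re)).add_const ((z.im : ℂ) * Complex.I)
    simp only [Complex.ofRealCLM_apply, Complex.ofReal_one] at this
    refine this.congr_of_eventuallyEq (Eventually.of_forall fun x => ?_)
    apply Complex.ext <;> simp
  exact (hg.hasFDerivAt.comp_hasDerivAt z.re hline).unique h

theorem Dv_eq_of_hasDerivAt {g : ℂ → ℝ} {z : ℂ} {d : ℝ} (hg : DifferentiableAt ℝ g z)
    (h : HasDerivAt (fun y : ℝ => g ⟨z.re, y⟩) d z.im) : Dv g z = d := by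
  have hline : HasDerivAt (fun y : ℝ => (⟨z.re, y⟩ : ℂ)) Complex.I z.im := by
    have := ((Complex.ofRealCLM.hasDerivAt (x := z.im)).mul_const Complex.I).const_add (z.re : ℂ)
    simp only [Complex.ofRealCLM_apply, Complex.ofReal_one, one_mul] at this
    refine this.congr_of_eventuallyEq (Eventually.of_forall fun x => ?_)
    apply Complex.ext <;> simp
  exact (hg.hasFDerivAt.comp_hasDerivAt z.im hline).unique h

theorem contDiffAt_Du {g : ℂ → ℝ} {z : ℂ} (hg : ContDiffAt ℝ ∞ g z) : ContDiffAt ℝ ∞ (Du g) z :=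
  (hg.fderiv_right (m := ∞) (by simp)).clm_apply contDiffAt_const

theorem contDiffAt_Dv {g : ℂ → ℝ} {z : ℂ} (hg : ContDiffAt ℝ ∞ g z) : ContDiffAt ℝ ∞ (Dv g) z :=
  (hg.fderiv_right (m := ∞) (by simp)).clm_apply contDiffAt_const

/-- The shear-like map `(a, b) ↦ (X (a, b), v₀ + m b)`. -/
def rowMap (X : ℂ → ℝ) (m v₀ : ℝ) (w : ℂ) : ℂ := ⟨X w, v₀ + m * w.im⟩

theorem hasFDerivAt_rowMap {X : ℂ → ℝ} {L : ℂ →L[ℝ] ℝ} {w : ℂ} (m v₀ : ℝ)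
    (hX : HasFDerivAt X L w) :
    HasFDerivAt (rowMap X m v₀)
      ((Complex.equivRealProdCLM.symm : ℝ × ℝ →L[ℝ] ℂ).comp (L.prod (m • Complex.imCLM))) w := by
  have h2 : HasFDerivAt (fun w : ℂ => v₀ + m * w.im) (m • Complex.imCLM) w :=
    (Complex.imCLM.hasFDerivAt.const_mul m).const_add v₀
  exact (Complex.equivRealProdCLM.symm.hasFDerivAt).comp w (hX.prodMk h2)

theorem contDiffAt_rowMap {X : ℂ → ℝ} {w : ℂ} (m v₀ : ℝ) (hX : ContDiffAt ℝ ∞ X w) :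
    ContDiffAt ℝ ∞ (rowMap X m v₀) w := by
  have h2 : ContDiffAt ℝ ∞ (fun w : ℂ => v₀ + m * w.im) w :=
    contDiffAt_const.add (contDiffAt_const.mul Complex.imCLM.contDiff.contDiffAt)
  exact (Complex.equivRealProdCLM.symm.contDiff.contDiffAt).comp w (hX.prodMk h2)

/-- Moving along a row changes only the abscissa, so the chain rule is triangular. It is used with
`G` the height to find the slopes, then with `G` a slope to find the second derivatives. -/
theorem Du_comp_rowMap {X g G : ℂ → ℝ} {m v₀ : ℝ} {w : ℂ} (hX : DifferentiableAt ℝ X w)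
    (hg : DifferentiableAt ℝ g (rowMap X m v₀ w))
    (hG : ∀ᶠ w' in 𝓝 w, g (rowMap X m v₀ w') = G w') :
    Du G w = Du X w * Du g (rowMap X m v₀ w) := by
  have h := hg.hasFDerivAt.comp w (hasFDerivAt_rowMap m v₀ hX.hasFDerivAt)
  have h' : HasFDerivAt G _ w := h.congr_of_eventuallyEq (hG.mono fun w' hw' => hw'.symm)
  unfold Du
  rw [h'.fderiv]
  have : (Complex.equivRealProdCLM.symm (fderiv ℝ X w 1, m * (1 : ℂ).im) : ℂ) =
      (fderiv ℝ X w 1) • (1 : ℂ) := by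
    apply Complex.ext <;> simp
  change fderiv ℝ g _ (Complex.equivRealProdCLM.symm (fderiv ℝ X w 1, m * (1 : ℂ).im)) = _
  rw [this, map_smul, smul_eq_mul]

theorem Dv_comp_rowMap {X g G : ℂ → ℝ} {m v₀ : ℝ} {w : ℂ} (hX : DifferentiableAt ℝ X w)
    (hg : DifferentiableAt ℝ g (rowMap X m v₀ w))
    (hG : ∀ᶠ w' in 𝓝 w, g (rowMap X m v₀ w') = G w') :
    Dv G w = Dv X w * Du g (rowMap X m v₀ w) + m * Dv g (rowMap X m v₀ w) := by
  have h := hg.hasFDerivAt.comp w (hasFDerivAt_rowMap m v₀ hX.hasFDerivAt)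
  have h' : HasFDerivAt G _ w := h.congr_of_eventuallyEq (hG.mono fun w' hw' => hw'.symm)
  unfold Du Dv
  rw [h'.fderiv]
  have : (Complex.equivRealProdCLM.symm (fderiv ℝ X w Complex.I, m * Complex.I.im) : ℂ) =
      (fderiv ℝ X w Complex.I) • (1 : ℂ) + m • Complex.I := by
    apply Complex.ext <;> simp
  change fderiv ℝ g _ (Complex.equivRealProdCLM.symm (fderiv ℝ X w Complex.I, m * Complex.I.im)) = _
  rw [this, map_add, map_smul, map_smul, smul_eq_mul, smul_eq_mul]

/-- Where `X` increases along rows, an injective row map has a smooth inverse. -/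
theorem contDiffAt_invFunOn_rowMap {X : ℂ → ℝ} {m v₀ : ℝ} {s : Set ℂ} {w : ℂ} (hs : IsOpen s)
    (hw : w ∈ s) (hm : m ≠ 0) (hX : ContDiffAt ℝ ∞ X w) (hX' : Du X w ≠ 0)
    (hinj : InjOn (rowMap X m v₀) s) :
    ContDiffAt ℝ ∞ (Function.invFunOn (rowMap X m v₀) s) (rowMap X m v₀ w) := by
  set L := fderiv ℝ X w with hL
  have hd := hasFDerivAt_rowMap m v₀ (hX.differentiableAt (by simp)).hasFDerivAt
  set D : ℂ →L[ℝ] ℂ :=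
    (Complex.equivRealProdCLM.symm : ℝ × ℝ →L[ℝ] ℂ).comp (L.prod (m • Complex.imCLM)) with hD
  -- The derivative is triangular with diagonal entries `Du X w` and `m`, both nonzero.
  have hDinj : Function.Injective D := by
    rw [injective_iff_map_eq_zero]
    intro v hv
    have h1 : (L v, m * v.im) = (0, 0) := by
      have : Complex.equivRealProdCLM.symm (L v, m * v.im) = 0 := hv
      simpa using this
    rw [Prod.mk.injEq] at h1
    have hvi : v.im = 0 := by simpa [hm] using h1.2
    have hv1 : v = v.re • (1 : ℂ) := by apply Complex.ext <;> simp [hvi]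
    have h2 := h1.1
    rw [hv1, map_smul, smul_eq_mul] at h2
    have hvr : v.re = 0 := (mul_eq_zero.1 h2).resolve_right hX'
    exact Complex.ext hvr hvi
  let e : ℂ ≃L[ℝ] ℂ :=
    (LinearEquiv.ofInjectiveEndo (D : ℂ →ₗ[ℝ] ℂ) hDinj).toContinuousLinearEquiv
  have he : HasFDerivAt (rowMap X m v₀) (e : ℂ →L[ℝ] ℂ) w := by
    have : (e : ℂ →L[ℝ] ℂ) = D := by ext; rfl
    rw [this]
    exact hd
  have hc := contDiffAt_rowMap m v₀ hX
  have hloc := hc.to_localInverse he (by simp)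
  have hst := hc.hasStrictFDerivAt' he (by simp)
  have hright := hst.eventually_right_inverse
  have hlw : hc.localInverse he (by simp) (rowMap X m v₀ w) = w := hst.localInverse_apply_image
  have hmem : ∀ᶠ z in 𝓝 (rowMap X m v₀ w), hc.localInverse he (by simp) z ∈ s := by
    apply hloc.continuousAt.eventually_mem
    rw [hlw]
    exact hs.mem_nhds hw
  refine hloc.congr_of_eventuallyEq ?_
  -- The local inverse lands in `s` and is a right inverse, so injectivity on `s` identifies it with
  -- the chosen global inverse.
  filter_upwards [hright, hmem] with z hz hzs
  have hz' : rowMap X m v₀ (hc.localInverse he (by simp) z) = z := hz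
  conv_lhs => rw [← hz']
  exact hinj.leftInvOn_invFunOn hzs

/-! ## The model Scherk type graph

For `A, B > 0` with `4 A B = 1` the surface is parametrized over the strip `0 < b < π / 2` by
`u = m (A arctan (tanh a cot b) + B arctan (tanh a tan b))`, `v = v₀ + m b` and
`height = (m / 2) (A log (cosh 2a - cos 2b) + B log (cosh 2a + cos 2b))`. -/

/-- The parameter strip `0 < b < π / 2`. -/
def strip : Set ℂ := {w | w.im ∈ Ioo 0 (Real.pi / 2)}

theorem isOpen_strip : IsOpen strip := isOpen_Ioo.preimage Complex.continuous_im

/-- The abscissa as a function of `x = tanh a` and `b`. -/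
noncomputable def rowAbscissa (A B x b : ℝ) : ℝ :=
  A * Real.arctan (x * (Real.cos b / Real.sin b)) + B * Real.arctan (x * (Real.sin b / Real.cos b))

/-- The abscissa on the parameter strip. -/
noncomputable def modelAbscissa (A B m : ℝ) (w : ℂ) : ℝ :=
  m * rowAbscissa A B (Real.sinh w.re / Real.cosh w.re) w.im

/-- The height as a function of `a` and `b`. -/
noncomputable def rowHeight (A B m a b : ℝ) : ℝ :=
  m / 2 * (A * Real.log (Real.cosh (2 * a) - Real.cos (2 * b)) +
    B * Real.log (Real.cosh (2 * a) + Real.cos (2 * b)))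

/-- The height on the parameter strip. -/
noncomputable def modelHeight (A B m : ℝ) (w : ℂ) : ℝ := rowHeight A B m w.re w.im

/-- The slope `f_u` of the model graph, on the parameter strip. -/
noncomputable def modelSlopeU (w : ℂ) : ℝ := Real.sinh (2 * w.re) / Real.sin (2 * w.im)

/-- The slope `f_v` of the model graph, on the parameter strip. -/
noncomputable def modelSlopeV (A B : ℝ) (w : ℂ) : ℝ :=
  ((A - B) * Real.cosh (2 * w.re) + (A + B) * Real.cos (2 * w.im)) / Real.sin (2 * w.im)

/-! ### Signs and factored forms of cosh 2a ± cos 2b on the strip -/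

section StripBounds

variable {a b : ℝ}

theorem sin_pos_of_mem_row (hb : b ∈ Ioo 0 (Real.pi / 2)) : 0 < Real.sin b :=
  Real.sin_pos_of_pos_of_lt_pi hb.1 (by linarith [hb.2, Real.pi_pos])

theorem cos_pos_of_mem_row (hb : b ∈ Ioo 0 (Real.pi / 2)) : 0 < Real.cos b :=
  Real.cos_pos_of_mem_Ioo ⟨by linarith [hb.1, Real.pi_pos], hb.2⟩

theorem sin_two_mul_pos_of_mem_row (hb : b ∈ Ioo 0 (Real.pi / 2)) : 0 < Real.sin (2 * b) :=
  Real.sin_pos_of_pos_of_lt_pi (by linarith [hb.1]) (by linarith [hb.2])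

theorem abs_cos_two_mul_lt_one (hb : b ∈ Ioo 0 (Real.pi / 2)) :
    -1 < Real.cos (2 * b) ∧ Real.cos (2 * b) < 1 := by
  have h := sin_two_mul_pos_of_mem_row hb
  have h1 := Real.sin_sq_add_cos_sq (2 * b)
  constructor <;> nlinarith

theorem cosh_sub_cos_pos (hb : b ∈ Ioo 0 (Real.pi / 2)) :
    0 < Real.cosh (2 * a) - Real.cos (2 * b) := by
  linarith [Real.one_le_cosh (2 * a), (abs_cos_two_mul_lt_one hb).2]

theorem cosh_add_cos_pos (hb : b ∈ Ioo 0 (Real.pi / 2)) :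
    0 < Real.cosh (2 * a) + Real.cos (2 * b) := by
  linarith [Real.one_le_cosh (2 * a), (abs_cos_two_mul_lt_one hb).1]

/-- Both sides are 2 |sinh(a + ib)|²; the form on the right is the one produced by differentiating
the arctangents. The companion identity below is the same for cosh. -/
theorem cosh_sub_cos_eq (a b : ℝ) : Real.cosh (2 * a) - Real.cos (2 * b) =
    2 * (Real.cosh a ^ 2 * Real.sin b ^ 2 + Real.sinh a ^ 2 * Real.cos b ^ 2) := by
  rw [Real.cosh_two_mul, Real.cos_two_mul']
  linear_combination (-Real.cosh a ^ 2 - Real.sinh a ^ 2) * Real.sin_sq_add_cos_sq b +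
    (Real.cos b ^ 2 - Real.sin b ^ 2) * Real.cosh_sq a

theorem cosh_add_cos_eq (a b : ℝ) : Real.cosh (2 * a) + Real.cos (2 * b) =
    2 * (Real.cosh a ^ 2 * Real.cos b ^ 2 + Real.sinh a ^ 2 * Real.sin b ^ 2) := by
  rw [Real.cosh_two_mul, Real.cos_two_mul']
  linear_combination (-Real.cosh a ^ 2 - Real.sinh a ^ 2) * Real.sin_sq_add_cos_sq b +
    (Real.sin b ^ 2 - Real.cos b ^ 2) * Real.cosh_sq a

end StripBounds

/-! ### Smoothness and partial derivatives of abscissa, height and slopes -/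

section Derivatives

variable {A B m : ℝ} {w : ℂ}

theorem contDiffAt_modelAbscissa (hw : w ∈ strip) : ContDiffAt ℝ ∞ (modelAbscissa A B m) w := by
  have h1 := (sin_pos_of_mem_row hw).ne'
  have h2 := (cos_pos_of_mem_row hw).ne'
  have h3 := (Real.cosh_pos w.re).ne'
  have hre : ContDiffAt ℝ ∞ (fun w : ℂ => w.re) w := Complex.reCLM.contDiff.contDiffAt
  have him : ContDiffAt ℝ ∞ (fun w : ℂ => w.im) w := Complex.imCLM.contDiff.contDiffAt
  unfold modelAbscissa rowAbscissa
  have hx : ContDiffAt ℝ ∞ (fun w : ℂ => Real.sinh w.re / Real.cosh w.re) w := hre.sinh.div hre.cosh h3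
  exact contDiffAt_const.mul ((contDiffAt_const.mul (hx.mul (him.cos.div him.sin h1)).arctan).add
    (contDiffAt_const.mul (hx.mul (him.sin.div him.cos h2)).arctan))

theorem contDiffAt_modelHeight (hw : w ∈ strip) : ContDiffAt ℝ ∞ (modelHeight A B m) w := by
  have h1 := (cosh_sub_cos_pos (a := w.re) hw).ne'
  have h2 := (cosh_add_cos_pos (a := w.re) hw).ne'
  have hre : ContDiffAt ℝ ∞ (fun w : ℂ => 2 * w.re) w :=
    contDiffAt_const.mul Complex.reCLM.contDiff.contDiffAt
  have him : ContDiffAt ℝ ∞ (fun w : ℂ => 2 * w.im) w :=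
    contDiffAt_const.mul Complex.imCLM.contDiff.contDiffAt
  unfold modelHeight rowHeight
  exact contDiffAt_const.mul ((contDiffAt_const.mul ((hre.cosh.sub him.cos).log h1)).add
    (contDiffAt_const.mul ((hre.cosh.add him.cos).log h2)))

theorem contDiffAt_modelSlopeU (hw : w ∈ strip) : ContDiffAt ℝ ∞ modelSlopeU w := by
  have h1 := (sin_two_mul_pos_of_mem_row hw).ne'
  have hre : ContDiffAt ℝ ∞ (fun w : ℂ => 2 * w.re) w :=
    contDiffAt_const.mul Complex.reCLM.contDiff.contDiffAt
  have him : ContDiffAt ℝ ∞ (fun w : ℂ => 2 * w.im) w :=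
    contDiffAt_const.mul Complex.imCLM.contDiff.contDiffAt
  exact hre.sinh.div him.sin h1

theorem contDiffAt_modelSlopeV (hw : w ∈ strip) : ContDiffAt ℝ ∞ (modelSlopeV A B) w := by
  have h1 := (sin_two_mul_pos_of_mem_row hw).ne'
  have hre : ContDiffAt ℝ ∞ (fun w : ℂ => 2 * w.re) w :=
    contDiffAt_const.mul Complex.reCLM.contDiff.contDiffAt
  have him : ContDiffAt ℝ ∞ (fun w : ℂ => 2 * w.im) w :=
    contDiffAt_const.mul Complex.imCLM.contDiff.contDiffAt
  exact ((contDiffAt_const.mul hre.cosh).add (contDiffAt_const.mul him.cos)).div him.sin h1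

theorem Du_modelAbscissa (hw : w ∈ strip) : Du (modelAbscissa A B m) w =
    m * Real.sin (2 * w.im) * (A / (Real.cosh (2 * w.re) - Real.cos (2 * w.im)) +
      B / (Real.cosh (2 * w.re) + Real.cos (2 * w.im))) := by
  refine Du_eq_of_hasDerivAt ((contDiffAt_modelAbscissa hw).differentiableAt (by simp)) ?_
  have h1 := sin_pos_of_mem_row hw
  have h2 := cos_pos_of_mem_row hw
  have h3 := Real.cosh_pos w.re
  have hx : HasDerivAt (fun a => Real.sinh a / Real.cosh a) _ w.re :=
    (Real.hasDerivAt_sinh w.re).div (Real.hasDerivAt_cosh w.re) h3.ne'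
  have h := ((((hx.mul_const (Real.cos w.im / Real.sin w.im)).arctan).const_mul A).add
    (((hx.mul_const (Real.sin w.im / Real.cos w.im)).arctan).const_mul B)).const_mul m
  refine HasDerivAt.congr_deriv h ?_
  have e := Real.cosh_sq' w.re
  rw [cosh_sub_cos_eq, cosh_add_cos_eq, Real.sin_two_mul]
  have e1 : Real.cosh w.re * Real.cosh w.re - Real.sinh w.re * Real.sinh w.re = 1 := by
    linear_combination e
  rw [e1]
  have d1 : 1 + (Real.sinh w.re / Real.cosh w.re * (Real.cos w.im / Real.sin w.im)) ^ 2 =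
      (Real.cosh w.re ^ 2 * Real.sin w.im ^ 2 + Real.sinh w.re ^ 2 * Real.cos w.im ^ 2) /
      (Real.cosh w.re ^ 2 * Real.sin w.im ^ 2) := by
    field_simp
  have d2 : 1 + (Real.sinh w.re / Real.cosh w.re * (Real.sin w.im / Real.cos w.im)) ^ 2 =
      (Real.cosh w.re ^ 2 * Real.cos w.im ^ 2 + Real.sinh w.re ^ 2 * Real.sin w.im ^ 2) /
      (Real.cosh w.re ^ 2 * Real.cos w.im ^ 2) := by
    field_simp
  rw [d1, d2]
  field_simp

theorem Dv_modelAbscissa (hw : w ∈ strip) : Dv (modelAbscissa A B m) w =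
    m * Real.sinh (2 * w.re) * (-A / (Real.cosh (2 * w.re) - Real.cos (2 * w.im)) +
      B / (Real.cosh (2 * w.re) + Real.cos (2 * w.im))) := by
  refine Dv_eq_of_hasDerivAt ((contDiffAt_modelAbscissa hw).differentiableAt (by simp)) ?_
  have h1 := sin_pos_of_mem_row hw
  have h2 := cos_pos_of_mem_row hw
  have h3 := Real.cosh_pos w.re
  have hx : HasDerivAt (fun b => Real.cos b / Real.sin b) _ w.im :=
    (Real.hasDerivAt_cos w.im).div (Real.hasDerivAt_sin w.im) h1.ne'
  have hy : HasDerivAt (fun b => Real.sin b / Real.cos b) _ w.im :=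
    (Real.hasDerivAt_sin w.im).div (Real.hasDerivAt_cos w.im) h2.ne'
  have h := ((((hx.const_mul (Real.sinh w.re / Real.cosh w.re)).arctan).const_mul A).add
    (((hy.const_mul (Real.sinh w.re / Real.cosh w.re)).arctan).const_mul B)).const_mul m
  refine HasDerivAt.congr_deriv h ?_
  have e := Real.sin_sq_add_cos_sq w.im
  rw [cosh_sub_cos_eq, cosh_add_cos_eq, Real.sinh_two_mul]
  have e1 : -Real.sin w.im * Real.sin w.im - Real.cos w.im * Real.cos w.im = -1 := by
    linear_combination -e
  have e2 : Real.cos w.im * Real.cos w.im - Real.sin w.im * -Real.sin w.im = 1 := by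
    linear_combination e
  rw [e1, e2]
  have d1 : 1 + (Real.sinh w.re / Real.cosh w.re * (Real.cos w.im / Real.sin w.im)) ^ 2 =
      (Real.cosh w.re ^ 2 * Real.sin w.im ^ 2 + Real.sinh w.re ^ 2 * Real.cos w.im ^ 2) /
      (Real.cosh w.re ^ 2 * Real.sin w.im ^ 2) := by
    field_simp
  have d2 : 1 + (Real.sinh w.re / Real.cosh w.re * (Real.sin w.im / Real.cos w.im)) ^ 2 =
      (Real.cosh w.re ^ 2 * Real.cos w.im ^ 2 + Real.sinh w.re ^ 2 * Real.sin w.im ^ 2) /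
      (Real.cosh w.re ^ 2 * Real.cos w.im ^ 2) := by
    field_simp
  rw [d1, d2]
  field_simp

theorem hasDerivAt_two_mul (x : ℝ) : HasDerivAt (fun x : ℝ => 2 * x) 2 x := by
  simpa using (hasDerivAt_id x).const_mul 2

theorem Du_modelHeight (hw : w ∈ strip) : Du (modelHeight A B m) w =
    m * Real.sinh (2 * w.re) * (A / (Real.cosh (2 * w.re) - Real.cos (2 * w.im)) +
      B / (Real.cosh (2 * w.re) + Real.cos (2 * w.im))) := by
  refine Du_eq_of_hasDerivAt ((contDiffAt_modelHeight hw).differentiableAt (by simp)) ?_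
  have h1 := (cosh_sub_cos_pos (a := w.re) hw).ne'
  have h2 := (cosh_add_cos_pos (a := w.re) hw).ne'
  have hc := (hasDerivAt_two_mul w.re).cosh
  have h := ((((hc.sub_const (Real.cos (2 * w.im))).log h1).const_mul A).add
    (((hc.add_const (Real.cos (2 * w.im))).log h2).const_mul B)).const_mul (m / 2)
  refine HasDerivAt.congr_deriv h ?_
  field_simp

theorem Dv_modelHeight (hw : w ∈ strip) : Dv (modelHeight A B m) w =
    m * Real.sin (2 * w.im) * (A / (Real.cosh (2 * w.re) - Real.cos (2 * w.im)) -
      B / (Real.cosh (2 * w.re) + Real.cos (2 * w.im))) := by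
  refine Dv_eq_of_hasDerivAt ((contDiffAt_modelHeight hw).differentiableAt (by simp)) ?_
  have h1 := (cosh_sub_cos_pos (a := w.re) hw).ne'
  have h2 := (cosh_add_cos_pos (a := w.re) hw).ne'
  have hc := (hasDerivAt_two_mul w.im).cos
  have h := ((((hc.const_sub (Real.cosh (2 * w.re))).log h1).const_mul A).add
    (((hc.const_add (Real.cosh (2 * w.re))).log h2).const_mul B)).const_mul (m / 2)
  refine HasDerivAt.congr_deriv h ?_
  field_simp
  ring

theorem Du_modelSlopeU (hw : w ∈ strip) :
    Du modelSlopeU w = 2 * Real.cosh (2 * w.re) / Real.sin (2 * w.im) := by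
  refine Du_eq_of_hasDerivAt ((contDiffAt_modelSlopeU hw).differentiableAt (by simp)) ?_
  refine HasDerivAt.congr_deriv ((hasDerivAt_two_mul w.re).sinh.div_const
    (Real.sin (2 * w.im))) ?_
  ring

theorem Dv_modelSlopeU (hw : w ∈ strip) : Dv modelSlopeU w =
    -2 * Real.sinh (2 * w.re) * Real.cos (2 * w.im) / Real.sin (2 * w.im) ^ 2 := by
  refine Dv_eq_of_hasDerivAt ((contDiffAt_modelSlopeU hw).differentiableAt (by simp)) ?_
  have h1 := (sin_two_mul_pos_of_mem_row hw).ne'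
  refine HasDerivAt.congr_deriv ((hasDerivAt_const w.im (Real.sinh (2 * w.re))).div
    (hasDerivAt_two_mul w.im).sin h1) ?_
  ring

theorem Du_modelSlopeV (hw : w ∈ strip) :
    Du (modelSlopeV A B) w = 2 * (A - B) * Real.sinh (2 * w.re) / Real.sin (2 * w.im) := by
  refine Du_eq_of_hasDerivAt ((contDiffAt_modelSlopeV hw).differentiableAt (by simp)) ?_
  refine HasDerivAt.congr_deriv ((((hasDerivAt_two_mul w.re).cosh.const_mul (A - B)).add_const
    ((A + B) * Real.cos (2 * w.im))).div_const (Real.sin (2 * w.im))) ?_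
  ring

theorem Dv_modelSlopeV (hw : w ∈ strip) : Dv (modelSlopeV A B) w =
    -2 * ((A + B) + (A - B) * Real.cosh (2 * w.re) * Real.cos (2 * w.im)) /
      Real.sin (2 * w.im) ^ 2 := by
  refine Dv_eq_of_hasDerivAt ((contDiffAt_modelSlopeV hw).differentiableAt (by simp)) ?_
  have h1 := (sin_two_mul_pos_of_mem_row hw).ne'
  refine HasDerivAt.congr_deriv ((((hasDerivAt_two_mul w.im).cos.const_mul (A + B)).const_add
    ((A - B) * Real.cosh (2 * w.re))).div (hasDerivAt_two_mul w.im).sin h1) ?_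
  congr 1
  linear_combination (-2 * (A + B)) * Real.sin_sq_add_cos_sq (2 * w.im)

end Derivatives

/-! ### The abscissa along a row and limits at the ends of the strip -/

section Rows

variable {A B : ℝ}

theorem rowAbscissa_strictMono (hA : 0 < A) (hB : 0 < B) {b : ℝ} (hb : b ∈ Ioo 0 (Real.pi / 2)) :
    StrictMono fun x => rowAbscissa A B x b := by
  have h1 := sin_pos_of_mem_row hb
  have h2 := cos_pos_of_mem_row hb
  intro x y hxy
  unfold rowAbscissa
  have e1 : Real.arctan (x * (Real.cos b / Real.sin b)) <
      Real.arctan (y * (Real.cos b / Real.sin b)) :=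
    Real.arctan_strictMono (mul_lt_mul_of_pos_right hxy (by positivity))
  have e2 : Real.arctan (x * (Real.sin b / Real.cos b)) <
      Real.arctan (y * (Real.sin b / Real.cos b)) :=
    Real.arctan_strictMono (mul_lt_mul_of_pos_right hxy (by positivity))
  exact add_lt_add (mul_lt_mul_of_pos_left e1 hA) (mul_lt_mul_of_pos_left e2 hB)

theorem rowAbscissa_neg (x b : ℝ) : rowAbscissa A B (-x) b = -rowAbscissa A B x b := by
  simp only [rowAbscissa, neg_mul, Real.arctan_neg]
  ring

theorem rowAbscissa_zero (b : ℝ) : rowAbscissa A B 0 b = 0 := by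
  simp [rowAbscissa]

/-- The value x = 1 is the limit of tanh a as a → ∞. There the arctangents invert the cotangent and
tangent, leaving an affine function of b: this is why the legs are straight. -/
theorem rowAbscissa_one {b : ℝ} (hb : b ∈ Ioo 0 (Real.pi / 2)) :
    rowAbscissa A B 1 b = A * (Real.pi / 2 - b) + B * b := by
  unfold rowAbscissa
  rw [one_mul, one_mul, ← Real.tan_eq_sin_div_cos, ← Real.sin_pi_div_two_sub,
    ← Real.cos_pi_div_two_sub b, ← Real.tan_eq_sin_div_cos, Real.arctan_tan, Real.arctan_tan] <;>
  linarith [hb.1, hb.2]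

theorem abs_rowAbscissa (hA : 0 < A) (hB : 0 < B) {b : ℝ} (hb : b ∈ Ioo 0 (Real.pi / 2)) (x : ℝ) :
    |rowAbscissa A B x b| = rowAbscissa A B |x| b := by
  have h := (rowAbscissa_strictMono hA hB hb).monotone
  have h0 := rowAbscissa_zero (A := A) (B := B) b
  rcases le_total 0 x with hx | hx
  · rw [abs_of_nonneg hx, abs_of_nonneg]
    simpa [h0] using h hx
  · rw [abs_of_nonpos hx, rowAbscissa_neg, abs_of_nonpos]
    simpa [h0] using h hx

theorem rowAbscissa_pi_div_two_sub (x b : ℝ) :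
    rowAbscissa A B x (Real.pi / 2 - b) = rowAbscissa B A x b := by
  simp only [rowAbscissa, Real.sin_pi_div_two_sub, Real.cos_pi_div_two_sub]
  ring

theorem rowHeight_pi_div_two_sub (m a b : ℝ) :
    rowHeight A B m a (Real.pi / 2 - b) = rowHeight B A m a b := by
  unfold rowHeight
  rw [show 2 * (Real.pi / 2 - b) = Real.pi - 2 * b by ring, Real.cos_pi_sub, sub_neg_eq_add,
    ← sub_eq_add_neg]
  ring

theorem continuousAt_rowAbscissa {b : ℝ} (hb : b ∈ Ioo 0 (Real.pi / 2)) (x : ℝ) :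
    ContinuousAt (fun b => rowAbscissa A B x b) b := by
  have h1 := (sin_pos_of_mem_row hb).ne'
  have h2 := (cos_pos_of_mem_row hb).ne'
  unfold rowAbscissa
  fun_prop (disch := assumption)

theorem sinh_div_cosh_abs (a : ℝ) : |Real.sinh a / Real.cosh a| = Real.tanh |a| := by
  rw [abs_div, Real.abs_sinh, abs_of_pos (Real.cosh_pos a), Real.tanh_eq_sinh_div_cosh,
    Real.cosh_abs]

theorem tanh_strictMono : StrictMono Real.tanh := by
  intro x y hxy
  by_contra h
  have := Real.strictMonoOn_artanh.le_iff_le ⟨Real.neg_one_lt_tanh y, Real.tanh_lt_one y⟩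
    ⟨Real.neg_one_lt_tanh x, Real.tanh_lt_one x⟩
  rw [Real.artanh_tanh, Real.artanh_tanh] at this
  exact absurd (this.2 (not_lt.1 h)) (not_le.2 hxy)

theorem rowAbscissa_tanh_lt (hA : 0 < A) (hB : 0 < B) {b : ℝ} (hb : b ∈ Ioo 0 (Real.pi / 2))
    (a : ℝ) : |rowAbscissa A B (Real.sinh a / Real.cosh a) b| < A * (Real.pi / 2 - b) + B * b := by
  rw [abs_rowAbscissa hA hB hb, sinh_div_cosh_abs, ← rowAbscissa_one hb]
  exact rowAbscissa_strictMono hA hB hb (Real.tanh_lt_one _)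

theorem exists_rowAbscissa_eq {b u : ℝ} (hb : b ∈ Ioo 0 (Real.pi / 2))
    (hu : |u| < A * (Real.pi / 2 - b) + B * b) :
    ∃ a, rowAbscissa A B (Real.sinh a / Real.cosh a) b = u := by
  have hcont : ContinuousOn (fun x => rowAbscissa A B x b) (Icc (-1) 1) := by
    unfold rowAbscissa
    fun_prop
  have hu' := abs_lt.1 hu
  obtain ⟨x, hx, hxu⟩ := intermediate_value_Ioo (by norm_num) hcont (show u ∈ _ by
    rw [rowAbscissa_neg, rowAbscissa_one hb]; exact hu')
  refine ⟨Real.artanh x, ?_⟩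
  rw [← Real.tanh_eq_sinh_div_cosh, Real.tanh_artanh hx]
  exact hxu

variable {α : Type*} {l : Filter α} {a b : α → ℝ}

/-- If `|u|` tends to its supremum on a row, then `|a| → ∞`. -/
theorem tendsto_abs_atTop_of_rowAbscissa (hA : 0 < A) (hB : 0 < B) {b₀ : ℝ}
    (hb₀ : b₀ ∈ Ioo 0 (Real.pi / 2)) (hb : Tendsto b l (𝓝 b₀))
    (hu : Tendsto (fun i => |rowAbscissa A B (Real.sinh (a i) / Real.cosh (a i)) (b i)|) l
      (𝓝 (A * (Real.pi / 2 - b₀) + B * b₀))) :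
    Tendsto (fun i => |a i|) l atTop := by
  rw [tendsto_atTop]
  intro R
  -- Compare with the fixed level a = R, whose abscissa stays strictly below the supremum in the
  -- limit.
  have h1 : Tendsto (fun i => rowAbscissa A B (Real.tanh R) (b i)) l
      (𝓝 (rowAbscissa A B (Real.tanh R) b₀)) := (continuousAt_rowAbscissa hb₀ _).tendsto.comp hb
  have h2 : rowAbscissa A B (Real.tanh R) b₀ < A * (Real.pi / 2 - b₀) + B * b₀ := by
    rw [← rowAbscissa_one hb₀]
    exact rowAbscissa_strictMono hA hB hb₀ (Real.tanh_lt_one _)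
  filter_upwards [h1.eventually_lt hu h2, hb.eventually_mem (Ioo_mem_nhds hb₀.1 hb₀.2)]
    with i hi hbi
  rw [abs_rowAbscissa hA hB hbi, sinh_div_cosh_abs] at hi
  exact (tanh_strictMono.lt_iff_lt.1 ((rowAbscissa_strictMono hA hB hbi).lt_iff_lt.1 hi)).le

theorem tendsto_rowHeight_atTop (hA : 0 < A) (hB : 0 < B) {m : ℝ} (hm : 0 < m)
    (ha : Tendsto (fun i => |a i|) l atTop) :
    Tendsto (fun i => rowHeight A B m (a i) (b i)) l atTop := by
  have h1 : Tendsto (fun i => Real.cosh (2 * a i)) l atTop := by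
    refine tendsto_atTop_mono (fun i => ?_) ha
    have h2 := Real.cosh_abs (2 * a i)
    rw [← h2, abs_mul, abs_two]
    have h3 : |a i| ≤ Real.sinh (2 * |a i|) :=
      (by linarith [abs_nonneg (a i)] : |a i| ≤ 2 * |a i|).trans
        (Real.self_le_sinh_iff.2 (by positivity))
    exact h3.trans (Real.sinh_lt_cosh _).le
  have hm1 : Tendsto (fun i => Real.cosh (2 * a i) - Real.cos (2 * b i)) l atTop :=
    tendsto_atTop_mono (fun i => by linarith [Real.cos_le_one (2 * b i)])
      (tendsto_atTop_add_const_right l (-1) h1)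
  have hm2 : Tendsto (fun i => Real.cosh (2 * a i) + Real.cos (2 * b i)) l atTop :=
    tendsto_atTop_mono (fun i => by linarith [Real.neg_one_le_cos (2 * b i)])
      (tendsto_atTop_add_const_right l (-1) h1)
  exact (((Real.tendsto_log_atTop.comp hm1).const_mul_atTop hA).atTop_add_atTop
    ((Real.tendsto_log_atTop.comp hm2).const_mul_atTop hB)).const_mul_atTop (by positivity)

/-- If `b → 0` and `|u|` stays away from `A π / 2`, then `a → 0`. -/
theorem tendsto_zero_of_rowAbscissa (hA : 0 < A) (hB : 0 < B)
    (hb : Tendsto b l (𝓝[>] 0)) {r : ℝ} (hr : r < A * (Real.pi / 2))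
    (hu : Tendsto (fun i => |rowAbscissa A B (Real.sinh (a i) / Real.cosh (a i)) (b i)|) l (𝓝 r)) :
    Tendsto a l (𝓝 0) := by
  rw [tendsto_zero_iff_abs_tendsto_zero, tendsto_order]
  refine ⟨fun R hR => Eventually.of_forall fun i => hR.trans_le (abs_nonneg _), fun R hR => ?_⟩
  have hR' : 0 < Real.tanh R := by simpa using tanh_strictMono hR
  have hcot : Tendsto (fun b => Real.cos b / Real.sin b) (𝓝[>] 0) atTop := by
    have h1 : Tendsto Real.sin (𝓝[>] 0) (𝓝[>] 0) := by
      refine tendsto_nhdsWithin_iff.2 ⟨?_, ?_⟩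
      · simpa using (Real.continuous_sin.tendsto 0).mono_left nhdsWithin_le_nhds
      · filter_upwards [Ioo_mem_nhdsGT Real.pi_pos] with x hx
        exact Real.sin_pos_of_pos_of_lt_pi hx.1 hx.2
    have h2 : Tendsto Real.cos (𝓝[>] 0) (𝓝 1) := by
      simpa using (Real.continuous_cos.tendsto 0).mono_left nhdsWithin_le_nhds
    exact h2.pos_mul_atTop one_pos h1.inv_tendsto_nhdsGT_zero
  -- At the fixed level a = R the first arctangent term alone tends to A π/2 > r; the second is
  -- nonnegative and can be dropped. Hence eventually |a| < R.
  have h1 : Tendsto (fun i => A * Real.arctan (Real.tanh R * (Real.cos (b i) / Real.sin (b i)))) l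
      (𝓝 (A * (Real.pi / 2))) :=
    ((Real.tendsto_arctan_atTop.mono_right nhdsWithin_le_nhds).comp
      ((hcot.comp hb).const_mul_atTop hR')).const_mul A
  have hbm : ∀ᶠ i in l, b i ∈ Ioo 0 (Real.pi / 2) :=
    hb.eventually (Ioo_mem_nhdsGT (by have := Real.pi_pos; positivity))
  filter_upwards [hu.eventually_lt h1 hr, hbm] with i hi hbi
  rw [abs_rowAbscissa hA hB hbi, sinh_div_cosh_abs] at hi
  refine tanh_strictMono.lt_iff_lt.1 ((rowAbscissa_strictMono hA hB hbi).lt_iff_lt.1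
    (hi.trans_le ?_))
  have := sin_pos_of_mem_row hbi
  have := cos_pos_of_mem_row hbi
  have : 0 ≤ Real.arctan (Real.tanh R * (Real.sin (b i) / Real.cos (b i))) :=
    Real.arctan_nonneg.2 (by positivity)
  exact le_add_of_nonneg_right (by positivity)

/-- Only the first logarithm diverges as (a, b) → 0; the second converges, so the sign of `B` is
irrelevant. -/
theorem tendsto_rowHeight_atBot (hA : 0 < A) {m : ℝ} (hm : 0 < m)
    (hb : Tendsto b l (𝓝[>] 0)) (ha : Tendsto a l (𝓝 0)) :
    Tendsto (fun i => rowHeight A B m (a i) (b i)) l atBot := by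
  have hc : Tendsto (fun i => Real.cosh (2 * a i)) l (𝓝 1) := by
    have : Continuous fun a => Real.cosh (2 * a) := by fun_prop
    simpa [Function.comp_def] using (this.tendsto 0).comp ha
  have hs : Tendsto (fun i => Real.cos (2 * b i)) l (𝓝 1) := by
    have : Continuous fun a => Real.cos (2 * a) := by fun_prop
    simpa [Function.comp_def] using (this.tendsto 0).comp (hb.mono_right nhdsWithin_le_nhds)
  have hbm : ∀ᶠ i in l, b i ∈ Ioo 0 (Real.pi / 2) :=
    hb.eventually (Ioo_mem_nhdsGT (by have := Real.pi_pos; positivity))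
  have h1 : Tendsto (fun i => Real.cosh (2 * a i) - Real.cos (2 * b i)) l (𝓝[>] 0) :=
    tendsto_nhdsWithin_iff.2 ⟨by simpa using hc.sub hs, hbm.mono fun i hi => cosh_sub_cos_pos hi⟩
  have h2 : Tendsto (fun i => B * Real.log (Real.cosh (2 * a i) + Real.cos (2 * b i))) l
      (𝓝 (B * Real.log (1 + 1))) :=
    ((hc.add hs).log (by norm_num)).const_mul B
  exact (((Real.tendsto_log_nhdsGT_zero.comp h1).const_mul_atBot hA).atBot_add
    h2).const_mul_atBot (by positivity)

end Rows

/-! ## The graph over the model trapezoid -/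

section Graph

variable {A B m v₀ : ℝ}

/-- The open trapezoid over which the model graph lives. -/
def modelDomain (A B m v₀ : ℝ) : Set ℂ :=
  {z | v₀ < z.im ∧ z.im < v₀ + m * (Real.pi / 2) ∧
    |z.re| < A * (m * (Real.pi / 2) - (z.im - v₀)) + B * (z.im - v₀)}

/-- The parametrization of the model trapezoid by the strip. -/
noncomputable def modelMap (A B m v₀ : ℝ) : ℂ → ℂ := rowMap (modelAbscissa A B m) m v₀

/-- The inverse of `modelMap` on the model trapezoid. -/
noncomputable def modelInv (A B m v₀ : ℝ) : ℂ → ℂ := Function.invFunOn (modelMap A B m v₀) strip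

/-- The model Scherk type graph. -/
noncomputable def modelGraph (A B m v₀ : ℝ) (z : ℂ) : ℝ :=
  modelHeight A B m (modelInv A B m v₀ z)

/-- The ordinate determines b, and on each row the abscissa is strictly increasing in a with range
exactly the open horizontal section of the trapezoid. -/
theorem modelMap_bijOn (hA : 0 < A) (hB : 0 < B) (hm : 0 < m) :
    BijOn (modelMap A B m v₀) strip (modelDomain A B m v₀) := by
  refine ⟨fun w hw => ?_, fun w₁ h₁ w₂ h₂ h => ?_, fun z hz => ?_⟩
  · have h := rowAbscissa_tanh_lt hA hB hw w.re
    have hw' : w.im ∈ Ioo 0 (Real.pi / 2) := hw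
    refine ⟨?_, ?_, ?_⟩
    · have := mul_pos hm hw'.1
      simpa [modelMap, rowMap] using this
    · have := mul_lt_mul_of_pos_left hw'.2 hm
      simpa [modelMap, rowMap] using this
    · simp only [modelMap, rowMap, modelAbscissa, abs_mul, abs_of_pos hm]
      have := mul_lt_mul_of_pos_left h hm
      linarith
  · have hre := congrArg Complex.re h
    have him := congrArg Complex.im h
    simp only [modelMap, rowMap, modelAbscissa] at hre him
    have hi : w₁.im = w₂.im := mul_left_cancel₀ hm.ne' (add_left_cancel him)
    rw [hi] at hre
    have h3 := (rowAbscissa_strictMono hA hB h₂).injective (mul_left_cancel₀ hm.ne' hre)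
    rw [← Real.tanh_eq_sinh_div_cosh, ← Real.tanh_eq_sinh_div_cosh] at h3
    exact Complex.ext (tanh_strictMono.injective h3) hi
  · obtain ⟨h1, h2, h3⟩ := hz
    have hb : (z.im - v₀) / m ∈ Ioo 0 (Real.pi / 2) :=
      ⟨div_pos (by linarith) hm, by rw [div_lt_iff₀ hm]; linarith⟩
    obtain ⟨a, ha⟩ := exists_rowAbscissa_eq (A := A) (B := B) hb (u := z.re / m) (by
      rw [abs_div, abs_of_pos hm, div_lt_iff₀ hm]
      have : (A * (Real.pi / 2 - (z.im - v₀) / m) + B * ((z.im - v₀) / m)) * m =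
          A * (m * (Real.pi / 2) - (z.im - v₀)) + B * (z.im - v₀) := by
        field_simp
      rwa [this])
    refine ⟨⟨a, (z.im - v₀) / m⟩, hb, ?_⟩
    apply Complex.ext
    · simp only [modelMap, rowMap, modelAbscissa, ha]
      field_simp
    · simp only [modelMap, rowMap]
      field_simp
      ring

theorem modelInv_modelMap (hA : 0 < A) (hB : 0 < B) (hm : 0 < m) {w : ℂ} (hw : w ∈ strip) :
    modelInv A B m v₀ (modelMap A B m v₀ w) = w :=
  (modelMap_bijOn hA hB hm).injOn.leftInvOn_invFunOn hw

theorem modelMap_modelInv (hA : 0 < A) (hB : 0 < B) (hm : 0 < m) {z : ℂ}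
    (hz : z ∈ modelDomain A B m v₀) : modelMap A B m v₀ (modelInv A B m v₀ z) = z :=
  (modelMap_bijOn hA hB hm).surjOn.rightInvOn_invFunOn hz

theorem modelInv_mem (hA : 0 < A) (hB : 0 < B) (hm : 0 < m) {z : ℂ}
    (hz : z ∈ modelDomain A B m v₀) : modelInv A B m v₀ z ∈ strip :=
  (modelMap_bijOn hA hB hm).surjOn.mapsTo_invFunOn hz

theorem modelGraph_modelMap (hA : 0 < A) (hB : 0 < B) (hm : 0 < m) {w : ℂ} (hw : w ∈ strip) :
    modelGraph A B m v₀ (modelMap A B m v₀ w) = modelHeight A B m w := by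
  rw [modelGraph, modelInv_modelMap hA hB hm hw]

theorem Du_modelAbscissa_pos (hA : 0 < A) (hB : 0 < B) (hm : 0 < m) {w : ℂ} (hw : w ∈ strip) :
    0 < Du (modelAbscissa A B m) w := by
  rw [Du_modelAbscissa hw]
  have := sin_two_mul_pos_of_mem_row hw
  have := cosh_sub_cos_pos (a := w.re) hw
  have := cosh_add_cos_pos (a := w.re) hw
  positivity

theorem contDiffAt_modelGraph (hA : 0 < A) (hB : 0 < B) (hm : 0 < m) {w : ℂ} (hw : w ∈ strip) :
    ContDiffAt ℝ ∞ (modelGraph A B m v₀) (modelMap A B m v₀ w) := by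
  have h := contDiffAt_invFunOn_rowMap (v₀ := v₀) isOpen_strip hw hm.ne'
    (contDiffAt_modelAbscissa hw)
    (Du_modelAbscissa_pos hA hB hm hw).ne' (modelMap_bijOn hA hB hm).injOn
  refine ContDiffAt.comp (modelMap A B m v₀ w) (g := modelHeight A B m)
    (f := modelInv A B m v₀) ?_ h
  rw [modelInv_modelMap hA hB hm hw]
  exact contDiffAt_modelHeight hw

theorem Du_modelGraph (hA : 0 < A) (hB : 0 < B) (hm : 0 < m) {w : ℂ} (hw : w ∈ strip) :
    Du (modelGraph A B m v₀) (modelMap A B m v₀ w) = modelSlopeU w := by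
  have h := Du_comp_rowMap (g := modelGraph A B m v₀) (G := modelHeight A B m)
    ((contDiffAt_modelAbscissa hw).differentiableAt (by simp))
    ((contDiffAt_modelGraph hA hB hm hw).differentiableAt (by simp))
    ((isOpen_strip.eventually_mem hw).mono fun w' hw' => modelGraph_modelMap hA hB hm hw')
  have hpos := Du_modelAbscissa_pos hA hB hm hw
  refine mul_left_cancel₀ hpos.ne' (h.symm.trans ?_)
  have := sin_two_mul_pos_of_mem_row hw
  rw [Du_modelHeight hw, Du_modelAbscissa hw, modelSlopeU]
  field_simp

theorem Dv_modelGraph (hA : 0 < A) (hB : 0 < B) (hm : 0 < m) {w : ℂ} (hw : w ∈ strip) :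
    Dv (modelGraph A B m v₀) (modelMap A B m v₀ w) = modelSlopeV A B w := by
  have h := Dv_comp_rowMap (g := modelGraph A B m v₀) (G := modelHeight A B m)
    ((contDiffAt_modelAbscissa hw).differentiableAt (by simp))
    ((contDiffAt_modelGraph hA hB hm hw).differentiableAt (by simp))
    ((isOpen_strip.eventually_mem hw).mono fun w' hw' => modelGraph_modelMap hA hB hm hw')
  have hu := Du_modelGraph (v₀ := v₀) hA hB hm hw
  unfold modelMap at hu ⊢
  rw [hu, Dv_modelHeight hw, Dv_modelAbscissa hw] at h
  refine mul_left_cancel₀ hm.ne' (eq_sub_of_add_eq' h.symm |>.trans ?_)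
  have h1 := (sin_two_mul_pos_of_mem_row hw).ne'
  have h2 := (cosh_sub_cos_pos (a := w.re) hw).ne'
  have h3 := (cosh_add_cos_pos (a := w.re) hw).ne'
  have e1 := Real.sin_sq_add_cos_sq (2 * w.im)
  have e2 := Real.cosh_sq (2 * w.re)
  -- This factorization cancels both denominators left after eliminating f_u from the chain rule.
  have key : Real.sin (2 * w.im) ^ 2 + Real.sinh (2 * w.re) ^ 2 =
      (Real.cosh (2 * w.re) - Real.cos (2 * w.im)) *
        (Real.cosh (2 * w.re) + Real.cos (2 * w.im)) := by
    linear_combination e1 - e2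
  unfold modelSlopeU modelSlopeV
  set p := Real.cosh (2 * w.re) - Real.cos (2 * w.im) with hp
  set q := Real.cosh (2 * w.re) + Real.cos (2 * w.im) with hq
  have hsplit : m * Real.sin (2 * w.im) * (A / p - B / q) -
      m * Real.sinh (2 * w.re) * (-A / p + B / q) * (Real.sinh (2 * w.re) / Real.sin (2 * w.im)) =
      m * ((Real.sin (2 * w.im) ^ 2 + Real.sinh (2 * w.re) ^ 2) * (A / p - B / q)) /
        Real.sin (2 * w.im) := by
    field_simp
    ring
  rw [hsplit, key]
  field_simp
  rw [hp, hq]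
  ring

theorem Du_Du_modelGraph (hA : 0 < A) (hB : 0 < B) (hm : 0 < m) {w : ℂ} (hw : w ∈ strip) :
    Du modelSlopeU w = Du (modelAbscissa A B m) w *
      Du (Du (modelGraph A B m v₀)) (modelMap A B m v₀ w) :=
  Du_comp_rowMap ((contDiffAt_modelAbscissa hw).differentiableAt (by simp))
    ((contDiffAt_Du (contDiffAt_modelGraph hA hB hm hw)).differentiableAt (by simp))
    ((isOpen_strip.eventually_mem hw).mono fun w' hw' => Du_modelGraph hA hB hm hw')

theorem Dv_Du_modelGraph (hA : 0 < A) (hB : 0 < B) (hm : 0 < m) {w : ℂ} (hw : w ∈ strip) :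
    Dv modelSlopeU w = Dv (modelAbscissa A B m) w *
      Du (Du (modelGraph A B m v₀)) (modelMap A B m v₀ w) +
      m * Dv (Du (modelGraph A B m v₀)) (modelMap A B m v₀ w) :=
  Dv_comp_rowMap ((contDiffAt_modelAbscissa hw).differentiableAt (by simp))
    ((contDiffAt_Du (contDiffAt_modelGraph hA hB hm hw)).differentiableAt (by simp))
    ((isOpen_strip.eventually_mem hw).mono fun w' hw' => Du_modelGraph hA hB hm hw')

theorem Du_Dv_modelGraph (hA : 0 < A) (hB : 0 < B) (hm : 0 < m) {w : ℂ} (hw : w ∈ strip) :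
    Du (modelSlopeV A B) w = Du (modelAbscissa A B m) w *
      Du (Dv (modelGraph A B m v₀)) (modelMap A B m v₀ w) :=
  Du_comp_rowMap ((contDiffAt_modelAbscissa hw).differentiableAt (by simp))
    ((contDiffAt_Dv (contDiffAt_modelGraph hA hB hm hw)).differentiableAt (by simp))
    ((isOpen_strip.eventually_mem hw).mono fun w' hw' => Dv_modelGraph hA hB hm hw')

theorem Dv_Dv_modelGraph (hA : 0 < A) (hB : 0 < B) (hm : 0 < m) {w : ℂ} (hw : w ∈ strip) :
    Dv (modelSlopeV A B) w = Dv (modelAbscissa A B m) w *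
      Du (Dv (modelGraph A B m v₀)) (modelMap A B m v₀ w) +
      m * Dv (Dv (modelGraph A B m v₀)) (modelMap A B m v₀ w) :=
  Dv_comp_rowMap ((contDiffAt_modelAbscissa hw).differentiableAt (by simp))
    ((contDiffAt_Dv (contDiffAt_modelGraph hA hB hm hw)).differentiableAt (by simp))
    ((isOpen_strip.eventually_mem hw).mono fun w' hw' => Dv_modelGraph hA hB hm hw')

end Graph

/-! ### Second derivatives, the minimal surface equation, and curvature on the axis -/

section MinimalSurfaceEquation

variable {A B m v₀ : ℝ} {w : ℂ}

/-- The expression regroups as A (cosh + cos) + B (cosh - cos). It is the numerator of the row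
derivative of the abscissa, hence a denominator of every second derivative. -/
theorem modelWeight_pos (hA : 0 < A) (hB : 0 < B) (hw : w ∈ strip) :
    0 < (A + B) * Real.cosh (2 * w.re) + (A - B) * Real.cos (2 * w.im) := by
  have h1 := mul_pos hA (cosh_add_cos_pos (a := w.re) hw)
  have h2 := mul_pos hB (cosh_sub_cos_pos (a := w.re) hw)
  linarith

theorem Du_modelAbscissa_eq (hw : w ∈ strip) : Du (modelAbscissa A B m) w =
    m * Real.sin (2 * w.im) *
      ((A + B) * Real.cosh (2 * w.re) + (A - B) * Real.cos (2 * w.im)) /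
      (Real.cosh (2 * w.re) ^ 2 - Real.cos (2 * w.im) ^ 2) := by
  have h2 := (cosh_sub_cos_pos (a := w.re) hw).ne'
  have h3 := (cosh_add_cos_pos (a := w.re) hw).ne'
  rw [Du_modelAbscissa hw, show Real.cosh (2 * w.re) ^ 2 - Real.cos (2 * w.im) ^ 2 =
    (Real.cosh (2 * w.re) - Real.cos (2 * w.im)) * (Real.cosh (2 * w.re) + Real.cos (2 * w.im)) by
      ring]
  field_simp
  ring

theorem Dv_modelAbscissa_eq (hw : w ∈ strip) : Dv (modelAbscissa A B m) w =
    -m * Real.sinh (2 * w.re) *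
      ((A - B) * Real.cosh (2 * w.re) + (A + B) * Real.cos (2 * w.im)) /
      (Real.cosh (2 * w.re) ^ 2 - Real.cos (2 * w.im) ^ 2) := by
  have h2 := (cosh_sub_cos_pos (a := w.re) hw).ne'
  have h3 := (cosh_add_cos_pos (a := w.re) hw).ne'
  rw [Dv_modelAbscissa hw, show Real.cosh (2 * w.re) ^ 2 - Real.cos (2 * w.im) ^ 2 =
    (Real.cosh (2 * w.re) - Real.cos (2 * w.im)) * (Real.cosh (2 * w.re) + Real.cos (2 * w.im)) by
      ring]
  field_simp
  ring

theorem cosh_sq_sub_cos_sq_pos (hw : w ∈ strip) :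
    0 < Real.cosh (2 * w.re) ^ 2 - Real.cos (2 * w.im) ^ 2 := by
  have h2 := cosh_sub_cos_pos (a := w.re) hw
  have h3 := cosh_add_cos_pos (a := w.re) hw
  nlinarith

theorem Du_Du_modelGraph_eq (hA : 0 < A) (hB : 0 < B) (hm : 0 < m) (hw : w ∈ strip) :
    Du (Du (modelGraph A B m v₀)) (modelMap A B m v₀ w) =
      2 * Real.cosh (2 * w.re) * (Real.cosh (2 * w.re) ^ 2 - Real.cos (2 * w.im) ^ 2) /
      (m * Real.sin (2 * w.im) ^ 2 *
        ((A + B) * Real.cosh (2 * w.re) + (A - B) * Real.cos (2 * w.im))) := by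
  have h := Du_Du_modelGraph (v₀ := v₀) hA hB hm hw
  refine mul_left_cancel₀ (Du_modelAbscissa_pos hA hB hm hw).ne' (h.symm.trans ?_)
  have h1 := sin_two_mul_pos_of_mem_row hw
  have h2 := modelWeight_pos hA hB hw
  have h3 := cosh_sq_sub_cos_sq_pos hw
  rw [Du_modelSlopeU hw, Du_modelAbscissa_eq hw]
  set E := (A + B) * Real.cosh (2 * w.re) + (A - B) * Real.cos (2 * w.im)
  field_simp

theorem Dv_Du_modelGraph_eq (hA : 0 < A) (hB : 0 < B) (hm : 0 < m) (hw : w ∈ strip) :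
    Dv (Du (modelGraph A B m v₀)) (modelMap A B m v₀ w) =
      2 * Real.sinh (2 * w.re) * (A - B) *
        (Real.cosh (2 * w.re) ^ 2 - Real.cos (2 * w.im) ^ 2) /
      (m * Real.sin (2 * w.im) ^ 2 *
        ((A + B) * Real.cosh (2 * w.re) + (A - B) * Real.cos (2 * w.im))) := by
  have h := Dv_Du_modelGraph (v₀ := v₀) hA hB hm hw
  rw [Du_Du_modelGraph_eq hA hB hm hw, Dv_modelSlopeU hw, Dv_modelAbscissa_eq hw] at h
  refine mul_left_cancel₀ hm.ne' ((eq_sub_of_add_eq' h.symm).trans ?_)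
  have h1 := sin_two_mul_pos_of_mem_row hw
  have h2 := modelWeight_pos hA hB hw
  have h3 := cosh_sq_sub_cos_sq_pos hw
  set E := (A + B) * Real.cosh (2 * w.re) + (A - B) * Real.cos (2 * w.im) with hE
  field_simp
  rw [hE]
  ring

theorem Dv_Dv_modelGraph_eq (hA : 0 < A) (hB : 0 < B) (hm : 0 < m) (hw : w ∈ strip) :
    Dv (Dv (modelGraph A B m v₀)) (modelMap A B m v₀ w) =
      2 * ((A - B) * Real.sinh (2 * w.re) ^ 2 *
          ((A - B) * Real.cosh (2 * w.re) + (A + B) * Real.cos (2 * w.im)) -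
        ((A + B) + (A - B) * Real.cosh (2 * w.re) * Real.cos (2 * w.im)) *
          ((A + B) * Real.cosh (2 * w.re) + (A - B) * Real.cos (2 * w.im))) /
      (m * Real.sin (2 * w.im) ^ 2 *
        ((A + B) * Real.cosh (2 * w.re) + (A - B) * Real.cos (2 * w.im))) := by
  have h1 := sin_two_mul_pos_of_mem_row hw
  have h2 := modelWeight_pos hA hB hw
  have h3 := cosh_sq_sub_cos_sq_pos hw
  -- The mixed derivative in this order is computed afresh from f_v, so symmetry of second
  -- derivatives is not invoked.
  have hvu : Du (Dv (modelGraph A B m v₀)) (modelMap A B m v₀ w) =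
      2 * (A - B) * Real.sinh (2 * w.re) *
        (Real.cosh (2 * w.re) ^ 2 - Real.cos (2 * w.im) ^ 2) /
      (m * Real.sin (2 * w.im) ^ 2 *
        ((A + B) * Real.cosh (2 * w.re) + (A - B) * Real.cos (2 * w.im))) := by
    have h := Du_Dv_modelGraph (v₀ := v₀) hA hB hm hw
    refine mul_left_cancel₀ (Du_modelAbscissa_pos hA hB hm hw).ne' (h.symm.trans ?_)
    rw [Du_modelSlopeV hw, Du_modelAbscissa_eq hw]
    field_simp
  have h := Dv_Dv_modelGraph (v₀ := v₀) hA hB hm hw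
  rw [hvu, Dv_modelSlopeV hw, Dv_modelAbscissa_eq hw] at h
  refine mul_left_cancel₀ hm.ne' ((eq_sub_of_add_eq' h.symm).trans ?_)
  field_simp
  ring

theorem isMinimalGraph_modelGraph (hA : 0 < A) (hB : 0 < B) (hm : 0 < m) (hAB : 4 * A * B = 1) :
    IsMinimalGraph (modelGraph A B m v₀) (modelDomain A B m v₀) := by
  constructor
  · intro z hz
    have h := contDiffAt_modelGraph (v₀ := v₀) hA hB hm (modelInv_mem hA hB hm hz)
    rw [modelMap_modelInv hA hB hm hz] at h
    exact h.contDiffWithinAt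
  · intro z hz
    have hw := modelInv_mem hA hB hm hz
    rw [← modelMap_modelInv hA hB hm hz]
    set w := modelInv A B m v₀ z
    rw [Du_Du_modelGraph_eq hA hB hm hw, Dv_Du_modelGraph_eq hA hB hm hw,
      Dv_Dv_modelGraph_eq hA hB hm hw, Du_modelGraph hA hB hm hw, Dv_modelGraph hA hB hm hw]
    unfold modelSlopeU modelSlopeV
    have h1 := sin_two_mul_pos_of_mem_row hw
    have h2 := modelWeight_pos hA hB hw
    have e1 : Real.sin (2 * w.im) ^ 2 = 1 - Real.cos (2 * w.im) ^ 2 := Real.sin_sq _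
    have e2 : Real.sinh (2 * w.re) ^ 2 = Real.cosh (2 * w.re) ^ 2 - 1 := Real.sinh_sq _
    set C := Real.cosh (2 * w.re)
    set S := Real.sinh (2 * w.re)
    set c := Real.cos (2 * w.im)
    set s := Real.sin (2 * w.im)
    set E := (A + B) * C + (A - B) * c with hE
    set L := (A - B) * C + (A + B) * c with hL
    -- The left side equals C (c² - 1)(4AB - 1): this is where the conformality relation enters.
    have key : C * (s ^ 2 + L ^ 2) - (A - B) * S ^ 2 * L - ((A + B) + (A - B) * C * c) * E = 0 := by
      rw [e1, e2, hE, hL]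
      linear_combination (C * c ^ 2 - C) * hAB
    have hsum : s ^ 2 + S ^ 2 = C ^ 2 - c ^ 2 := by rw [e1, e2]; ring
    have : 2 * C * (C ^ 2 - c ^ 2) / (m * s ^ 2 * E) * (1 + (L / s) ^ 2) -
        2 * (S / s) * (L / s) * (2 * S * (A - B) * (C ^ 2 - c ^ 2) / (m * s ^ 2 * E)) +
        2 * ((A - B) * S ^ 2 * L - ((A + B) + (A - B) * C * c) * E) / (m * s ^ 2 * E) *
          (1 + (S / s) ^ 2) =
        2 / (m * s ^ 4 * E) * ((C ^ 2 - c ^ 2) *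
          (C * (s ^ 2 + L ^ 2) - (A - B) * S ^ 2 * L - ((A + B) + (A - B) * C * c) * E)) := by
      rw [show 1 + (S / s) ^ 2 = (C ^ 2 - c ^ 2) / s ^ 2 by rw [← hsum]; field_simp]
      field_simp
      ring
    rw [this, key]
    ring

/-- The abscissa vanishes at a = 0 and is strictly increasing in a, so the axis is the image of a =
0. -/
theorem modelGraph_axis (hA : 0 < A) (hB : 0 < B) (hm : 0 < m) {z : ℂ}
    (hz : z ∈ modelDomain A B m v₀) (h0 : z.re = 0) :
    (modelInv A B m v₀ z).re = 0 ∧ (modelInv A B m v₀ z).im = (z.im - v₀) / m := by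
  have hw := modelInv_mem hA hB hm hz
  have h := modelMap_modelInv hA hB hm hz
  set w := modelInv A B m v₀ z
  have hre := congrArg Complex.re h
  have him := congrArg Complex.im h
  simp only [modelMap, rowMap, modelAbscissa] at hre him
  constructor
  · rw [h0, ← rowAbscissa_zero (A := A) (B := B) w.im, ← Real.tanh_eq_sinh_div_cosh] at hre
    have h1 : m * rowAbscissa A B (Real.tanh w.re) w.im = m * rowAbscissa A B (Real.tanh 0) w.im := by
      rw [hre, Real.tanh_zero, rowAbscissa_zero, mul_zero]
    exact tanh_strictMono.injective
      ((rowAbscissa_strictMono hA hB hw).injective (mul_left_cancel₀ hm.ne' h1))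
  · rw [← him]
    field_simp
    ring

theorem Du_modelGraph_axis (hA : 0 < A) (hB : 0 < B) (hm : 0 < m) {z : ℂ}
    (hz : z ∈ modelDomain A B m v₀) (h0 : z.re = 0) :
    Du (modelGraph A B m v₀) z = 0 ∧ Dv (Du (modelGraph A B m v₀)) z = 0 := by
  have hw := modelInv_mem hA hB hm hz
  have h1 := (modelGraph_axis hA hB hm hz h0).1
  rw [← modelMap_modelInv hA hB hm hz, Du_modelGraph hA hB hm hw, Dv_Du_modelGraph_eq hA hB hm hw,
    modelSlopeU, h1]
  simp

theorem gaussCurvature_modelGraph_axis (hA : 0 < A) (hB : 0 < B) (hm : 0 < m)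
    (hAB : 4 * A * B = 1) {z : ℂ} (hz : z ∈ modelDomain A B m v₀) (h0 : z.re = 0) :
    gaussCurvature (modelGraph A B m v₀) z =
      -(2 * Real.sin (2 * ((z.im - v₀) / m)) /
        (m * ((A + B) + (A - B) * Real.cos (2 * ((z.im - v₀) / m))) ^ 2)) ^ 2 := by
  have hw := modelInv_mem hA hB hm hz
  obtain ⟨h1, h2⟩ := modelGraph_axis hA hB hm hz h0
  have hs := sin_two_mul_pos_of_mem_row hw
  have hE := modelWeight_pos hA hB hw
  unfold gaussCurvature
  rw [← modelMap_modelInv hA hB hm hz, Du_modelGraph hA hB hm hw, Dv_modelGraph hA hB hm hw,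
    Du_Du_modelGraph_eq hA hB hm hw, Dv_Du_modelGraph_eq hA hB hm hw,
    Dv_Dv_modelGraph_eq hA hB hm hw, modelMap_modelInv hA hB hm hz, modelSlopeU, modelSlopeV]
  rw [h1, h2] at *
  have e1 : Real.sin (2 * ((z.im - v₀) / m)) ^ 2 = 1 - Real.cos (2 * ((z.im - v₀) / m)) ^ 2 :=
    Real.sin_sq _
  simp only [mul_zero, Real.cosh_zero, Real.sinh_zero, mul_one] at *
  set c := Real.cos (2 * ((z.im - v₀) / m))
  set s := Real.sin (2 * ((z.im - v₀) / m))
  -- Since (A + B)² - (A - B)² = 4AB = 1, the area factor on the axis is a perfect square, which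
  -- turns the curvature into minus a square.
  have hsum : 1 + (0 / s) ^ 2 + (((A - B) + (A + B) * c) / s) ^ 2 =
      (((A + B) + (A - B) * c) / s) ^ 2 := by
    rw [div_pow, div_pow, div_pow]
    field_simp
    rw [e1]
    linear_combination (c ^ 2 - 1) * hAB
  rw [hsum, show (1 : ℝ) ^ 2 - c ^ 2 = s ^ 2 by rw [e1]; ring]
  field_simp
  ring

end MinimalSurfaceEquation

/-! ### Boundary values of the model graph -/

section Boundary

variable {A B m v₀ : ℝ}

theorem modelInv_im (hA : 0 < A) (hB : 0 < B) (hm : 0 < m) {z : ℂ}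
    (hz : z ∈ modelDomain A B m v₀) : (modelInv A B m v₀ z).im = (z.im - v₀) / m := by
  have him := congrArg Complex.im (modelMap_modelInv hA hB hm hz)
  simp only [modelMap, rowMap] at him
  rw [eq_div_iff hm.ne']
  linarith

theorem abs_rowAbscissa_modelInv (hA : 0 < A) (hB : 0 < B) (hm : 0 < m) {z : ℂ}
    (hz : z ∈ modelDomain A B m v₀) :
    |rowAbscissa A B (Real.sinh (modelInv A B m v₀ z).re / Real.cosh (modelInv A B m v₀ z).re)
      (modelInv A B m v₀ z).im| = |z.re| / m := by
  have hre := congrArg Complex.re (modelMap_modelInv hA hB hm hz)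
  simp only [modelMap, rowMap, modelAbscissa] at hre
  rw [eq_div_iff hm.ne', ← hre, abs_mul, abs_of_pos hm, mul_comm]

theorem tendsto_modelInv_im (hA : 0 < A) (hB : 0 < B) (hm : 0 < m) (ζ : ℂ) :
    Tendsto (fun z => (modelInv A B m v₀ z).im) (𝓝[modelDomain A B m v₀] ζ)
      (𝓝 ((ζ.im - v₀) / m)) := by
  have h : Tendsto (fun z : ℂ => (z.im - v₀) / m) (𝓝[modelDomain A B m v₀] ζ)
      (𝓝 ((ζ.im - v₀) / m)) :=
    ((Complex.continuous_im.sub continuous_const).div_const m).continuousAt.mono_left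
      nhdsWithin_le_nhds
  refine h.congr' ?_
  filter_upwards [self_mem_nhdsWithin] with z hz
  exact (modelInv_im hA hB hm hz).symm

theorem tendsto_abs_rowAbscissa_modelInv (hA : 0 < A) (hB : 0 < B) (hm : 0 < m) (ζ : ℂ) :
    Tendsto (fun z => |rowAbscissa A B
        (Real.sinh (modelInv A B m v₀ z).re / Real.cosh (modelInv A B m v₀ z).re)
        (modelInv A B m v₀ z).im|) (𝓝[modelDomain A B m v₀] ζ) (𝓝 (|ζ.re| / m)) := by
  have h : Tendsto (fun z : ℂ => |z.re| / m) (𝓝[modelDomain A B m v₀] ζ) (𝓝 (|ζ.re| / m)) :=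
    (Complex.continuous_re.abs.div_const m).continuousAt.mono_left nhdsWithin_le_nhds
  refine h.congr' ?_
  filter_upwards [self_mem_nhdsWithin] with z hz
  exact (abs_rowAbscissa_modelInv hA hB hm hz).symm

theorem tendsto_modelGraph_leg (hA : 0 < A) (hB : 0 < B) (hm : 0 < m) {ζ : ℂ}
    (h1 : v₀ < ζ.im) (h2 : ζ.im < v₀ + m * (Real.pi / 2))
    (h3 : |ζ.re| = A * (m * (Real.pi / 2) - (ζ.im - v₀)) + B * (ζ.im - v₀)) :
    Tendsto (modelGraph A B m v₀) (𝓝[modelDomain A B m v₀] ζ) atTop := by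
  refine tendsto_rowHeight_atTop hA hB hm (tendsto_abs_atTop_of_rowAbscissa hA hB
    (b₀ := (ζ.im - v₀) / m) ⟨div_pos (by linarith) hm, by rw [div_lt_iff₀ hm]; linarith⟩
    (tendsto_modelInv_im hA hB hm ζ) ?_)
  have := tendsto_abs_rowAbscissa_modelInv (v₀ := v₀) hA hB hm ζ
  rw [h3] at this
  convert this using 2
  field_simp

theorem tendsto_modelGraph_bottom (hA : 0 < A) (hB : 0 < B) (hm : 0 < m) {ζ : ℂ}
    (h1 : ζ.im = v₀) (h2 : |ζ.re| < A * (m * (Real.pi / 2))) :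
    Tendsto (modelGraph A B m v₀) (𝓝[modelDomain A B m v₀] ζ) atBot := by
  have hb : Tendsto (fun z => (modelInv A B m v₀ z).im) (𝓝[modelDomain A B m v₀] ζ)
      (𝓝[>] 0) := by
    refine tendsto_nhdsWithin_iff.2 ⟨?_, ?_⟩
    · simpa [h1] using tendsto_modelInv_im (v₀ := v₀) hA hB hm ζ
    · filter_upwards [self_mem_nhdsWithin] with z hz
      exact (modelInv_mem hA hB hm hz).1
  exact tendsto_rowHeight_atBot hA hm hb (tendsto_zero_of_rowAbscissa hA hB hb
    (by rw [div_lt_iff₀ hm]; linarith) (tendsto_abs_rowAbscissa_modelInv hA hB hm ζ))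

/-- The reflection b ↦ π/2 - b exchanges `A` and `B`, reducing this to the limit at the lower base.
-/
theorem tendsto_modelGraph_top (hA : 0 < A) (hB : 0 < B) (hm : 0 < m) {ζ : ℂ}
    (h1 : ζ.im = v₀ + m * (Real.pi / 2)) (h2 : |ζ.re| < B * (m * (Real.pi / 2))) :
    Tendsto (modelGraph A B m v₀) (𝓝[modelDomain A B m v₀] ζ) atBot := by
  have hb : Tendsto (fun z => Real.pi / 2 - (modelInv A B m v₀ z).im)
      (𝓝[modelDomain A B m v₀] ζ) (𝓝[>] 0) := by
    refine tendsto_nhdsWithin_iff.2 ⟨?_, ?_⟩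
    · have := (tendsto_modelInv_im (v₀ := v₀) hA hB hm ζ).const_sub (Real.pi / 2)
      rw [h1] at this
      convert this using 2
      field_simp
      ring
    · filter_upwards [self_mem_nhdsWithin] with z hz
      exact sub_pos.2 (modelInv_mem hA hB hm hz).2
  have hu := tendsto_abs_rowAbscissa_modelInv (v₀ := v₀) hA hB hm ζ
  simp only [← rowAbscissa_pi_div_two_sub (A := B) (B := A)] at hu
  have := tendsto_rowHeight_atBot (B := A) hB hm hb (tendsto_zero_of_rowAbscissa hB hA hb
    (by rw [div_lt_iff₀ hm]; linarith) hu)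
  simp only [rowHeight_pi_div_two_sub] at this
  exact this

end Boundary

/-! ## The convex hull of a symmetric trapezoid -/

section Hull

variable {p q y₀ y₁ : ℝ}

/-- The half-width at height `y` of the trapezoid with half-widths `p` at `y₀` and `q` at `y₁`. -/
noncomputable def halfWidth (p q y₀ y₁ y : ℝ) : ℝ :=
  (p * (y₁ - y) + q * (y - y₀)) / (y₁ - y₀)

/-- For the harder inclusion, a point lies on a horizontal chord whose end points divide the two
legs in the same ratio θ. The half-width r is positive, so the point is an explicit convex
combination of those end points. -/
theorem convexHull_trapezoid (hp : 0 < p) (hq : 0 < q) (hy : y₀ < y₁) :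
    convexHull ℝ {(⟨p, y₀⟩ : ℂ), ⟨q, y₁⟩, ⟨-q, y₁⟩, ⟨-p, y₀⟩} =
      {z : ℂ | y₀ ≤ z.im ∧ z.im ≤ y₁ ∧ z.re ≤ halfWidth p q y₀ y₁ z.im ∧
        -z.re ≤ halfWidth p q y₀ y₁ z.im} := by
  have hd : 0 < y₁ - y₀ := by linarith
  have e0 : halfWidth p q y₀ y₁ y₀ = p := by unfold halfWidth; field_simp; ring
  have e1 : halfWidth p q y₀ y₁ y₁ = q := by unfold halfWidth; field_simp; ring
  apply Subset.antisymm
  · apply convexHull_min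
    · intro z hz
      rcases hz with rfl | rfl | rfl | rfl <;> simp [e0, e1] <;> constructor <;> linarith
    · intro z hz w hw a b ha hb hab
      obtain ⟨z1, z2, z3, z4⟩ := hz
      obtain ⟨w1, w2, w3, w4⟩ := hw
      have haff : halfWidth p q y₀ y₁ (a * z.im + b * w.im) =
          a * halfWidth p q y₀ y₁ z.im + b * halfWidth p q y₀ y₁ w.im := by
        unfold halfWidth
        field_simp
        linear_combination (p * y₁ - q * y₀) * (-hab)
      have hre : (a • z + b • w).re = a * z.re + b * w.re := by simp
      have him : (a • z + b • w).im = a * z.im + b * w.im := by simp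
      have hy0 : y₀ = a * y₀ + b * y₀ := by rw [← add_mul, hab, one_mul]
      have hy1 : y₁ = a * y₁ + b * y₁ := by rw [← add_mul, hab, one_mul]
      refine ⟨?_, ?_, ?_, ?_⟩
      · rw [him, hy0]; gcongr
      · rw [him, hy1]; gcongr
      · rw [him, hre, haff]; nlinarith
      · rw [him, hre, haff]; nlinarith
  · rintro z ⟨h1, h2, h3, h4⟩
    set V : Set ℂ := {(⟨p, y₀⟩ : ℂ), ⟨q, y₁⟩, ⟨-q, y₁⟩, ⟨-p, y₀⟩} with hV
    have hconv : Convex ℝ (convexHull ℝ V) := convex_convexHull ℝ V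
    have hsub := subset_convexHull ℝ V
    set r := halfWidth p q y₀ y₁ z.im with hr
    set θ := (z.im - y₀) / (y₁ - y₀) with hθ
    have hθ0 : 0 ≤ θ := div_nonneg (by linarith) hd.le
    have hθ1 : θ ≤ 1 := by rw [hθ, div_le_one hd]; linarith
    have hrθ : r = (1 - θ) * p + θ * q := by
      rw [hr, hθ]; unfold halfWidth; field_simp; ring
    have hyθ : z.im = (1 - θ) * y₀ + θ * y₁ := by
      rw [hθ]; field_simp; ring
    have hr0 : 0 < r := by
      rw [hrθ]
      rcases hθ0.eq_or_lt with h | h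
      · rw [← h]; simpa using hp
      · have := mul_pos h hq
        have := mul_nonneg (sub_nonneg.2 hθ1) hp.le
        linarith
    have hR : (⟨r, z.im⟩ : ℂ) ∈ convexHull ℝ V := by
      have := hconv (hsub (show (⟨p, y₀⟩ : ℂ) ∈ V by simp [hV]))
        (hsub (show (⟨q, y₁⟩ : ℂ) ∈ V by simp [hV])) (sub_nonneg.2 hθ1) hθ0 (by ring)
      convert this using 1
      apply Complex.ext <;> simp [hrθ, hyθ]
    have hL : (⟨-r, z.im⟩ : ℂ) ∈ convexHull ℝ V := by
      have := hconv (hsub (show (⟨-p, y₀⟩ : ℂ) ∈ V by simp [hV]))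
        (hsub (show (⟨-q, y₁⟩ : ℂ) ∈ V by simp [hV])) (sub_nonneg.2 hθ1) hθ0 (by ring)
      convert this using 1
      apply Complex.ext
      · simp [hrθ]; ring
      · simp [hyθ]
    have := hconv hL hR (a := (r - z.re) / (2 * r)) (b := (r + z.re) / (2 * r))
      (div_nonneg (by linarith) (by linarith)) (div_nonneg (by linarith) (by linarith))
      (by field_simp; ring)
    convert this using 1
    apply Complex.ext
    · simp only [Complex.add_re, Complex.smul_re, smul_eq_mul]
      field_simp
      ring
    · simp only [Complex.add_im, Complex.smul_im, smul_eq_mul]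
      field_simp
      ring

/-- A surjective functional is an open map, so taking preimages commutes with taking interiors. -/
theorem interior_setOf_clm_le {φ : ℂ →L[ℝ] ℝ} (hφ : Function.Surjective φ) (c : ℝ) :
    interior {z | φ z ≤ c} = {z | φ z < c} := by
  have h := (φ.isOpenMap hφ).preimage_interior_eq_interior_preimage φ.continuous (Iic c)
  rw [interior_Iic] at h
  exact h.symm

/-- The half-width is affine in the height, so the hull is an intersection of four half-planes, and
interiors commute with finite intersections. -/
theorem quad_trapezoid (hp : 0 < p) (hq : 0 < q) (hy : y₀ < y₁) :
    quad (⟨p, y₀⟩ : ℂ) ⟨q, y₁⟩ ⟨-q, y₁⟩ ⟨-p, y₀⟩ =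
      {z : ℂ | y₀ < z.im ∧ z.im < y₁ ∧ |z.re| < halfWidth p q y₀ y₁ z.im} := by
  have hd : 0 < y₁ - y₀ := by linarith
  set k := (q - p) / (y₁ - y₀) with hk
  set c := (p * y₁ - q * y₀) / (y₁ - y₀) with hc
  have hw : ∀ y, halfWidth p q y₀ y₁ y = k * y + c := fun y => by
    rw [hk, hc]; unfold halfWidth; field_simp; ring
  have hset : {z : ℂ | y₀ ≤ z.im ∧ z.im ≤ y₁ ∧ z.re ≤ halfWidth p q y₀ y₁ z.im ∧
        -z.re ≤ halfWidth p q y₀ y₁ z.im} =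
      {z | (-Complex.imCLM) z ≤ -y₀} ∩ ({z | Complex.imCLM z ≤ y₁} ∩
        ({z | (Complex.reCLM - k • Complex.imCLM) z ≤ c} ∩
          {z | (-Complex.reCLM - k • Complex.imCLM) z ≤ c})) := by
    ext z
    simp only [hw, mem_ofPred_eq, mem_inter_iff, neg_apply,
      sub_apply, smul_apply, Complex.imCLM_apply,
      Complex.reCLM_apply, smul_eq_mul]
    constructor
    · rintro ⟨h1, h2, h3, h4⟩
      exact ⟨by linarith, h2, by linarith, by linarith⟩
    · rintro ⟨h1, h2, h3, h4⟩
      exact ⟨by linarith, h2, by linarith, by linarith⟩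
  unfold quad
  rw [convexHull_trapezoid hp hq hy, hset, interior_inter, interior_inter, interior_inter,
    interior_setOf_clm_le (fun r => ⟨⟨0, -r⟩, by simp⟩),
    interior_setOf_clm_le (fun r => ⟨⟨0, r⟩, by simp⟩),
    interior_setOf_clm_le (fun r => ⟨⟨r, 0⟩, by simp⟩),
    interior_setOf_clm_le (fun r => ⟨⟨-r, 0⟩, by simp⟩)]
  ext z
  simp only [hw, mem_ofPred_eq, mem_inter_iff, neg_apply,
    sub_apply, smul_apply, Complex.imCLM_apply,
    Complex.reCLM_apply, smul_eq_mul, abs_lt]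
  constructor
  · rintro ⟨h1, h2, h3, h4⟩
    exact ⟨by linarith, h2, by linarith, by linarith⟩
  · rintro ⟨h1, h2, h3, h4⟩
    exact ⟨by linarith, h2, by linarith, by linarith⟩

end Hull

/-! ### The model graph over its quadrilateral -/

section ModelQuad

variable {A B m v₀ : ℝ}

theorem quad_eq_modelDomain (hA : 0 < A) (hB : 0 < B) (hm : 0 < m) :
    quad (⟨A * (m * (Real.pi / 2)), v₀⟩ : ℂ) ⟨B * (m * (Real.pi / 2)), v₀ + m * (Real.pi / 2)⟩
      ⟨-(B * (m * (Real.pi / 2))), v₀ + m * (Real.pi / 2)⟩ ⟨-(A * (m * (Real.pi / 2))), v₀⟩ =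
    modelDomain A B m v₀ := by
  have hH : 0 < m * (Real.pi / 2) := by have := Real.pi_pos; positivity
  rw [quad_trapezoid (by positivity) (by positivity) (by linarith)]
  unfold modelDomain halfWidth
  ext z
  have : (A * (m * (Real.pi / 2)) * (v₀ + m * (Real.pi / 2) - z.im) +
      B * (m * (Real.pi / 2)) * (z.im - v₀)) / (v₀ + m * (Real.pi / 2) - v₀) =
      A * (m * (Real.pi / 2) - (z.im - v₀)) + B * (z.im - v₀) := by
    rw [add_sub_cancel_left]
    generalize m * (Real.pi / 2) = H at hH
    field_simp
    ring
  simp only [mem_ofPred_eq, this]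

theorem isScherkTypeGraph_modelGraph (hA : 0 < A) (hB : 0 < B) (hm : 0 < m)
    (hAB : 4 * A * B = 1) :
    IsScherkTypeGraph (⟨A * (m * (Real.pi / 2)), v₀⟩ : ℂ)
      ⟨B * (m * (Real.pi / 2)), v₀ + m * (Real.pi / 2)⟩
      ⟨-(B * (m * (Real.pi / 2))), v₀ + m * (Real.pi / 2)⟩ ⟨-(A * (m * (Real.pi / 2))), v₀⟩
      (modelGraph A B m v₀) := by
  have hH : 0 < m * (Real.pi / 2) := by have := Real.pi_pos; positivity
  refine ⟨?_, ?_, ?_⟩ <;> rw [quad_eq_modelDomain hA hB hm]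
  · exact isMinimalGraph_modelGraph hA hB hm hAB
  -- The names are swapped on the second leg so that β is the weight of the upper vertex in both
  -- cases.
  · rintro ζ (⟨α, β, hα, hβ, hαβ, rfl⟩ | ⟨β, α, hβ, hα, hαβ, rfl⟩)
    all_goals
      obtain rfl : α = 1 - β := by linarith
      apply tendsto_modelGraph_leg hA hB hm <;>
      simp only [Complex.add_im, Complex.smul_im, Complex.add_re, Complex.smul_re, smul_eq_mul] <;>
      generalize m * (Real.pi / 2) = H at hH
      · nlinarith
      · nlinarith
    · rw [abs_of_pos (by positivity)]
      ring
    · rw [abs_of_neg (by have := mul_pos hα (mul_pos hA hH); have := mul_pos hβ (mul_pos hB hH)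
                         linarith)]
      ring
  · rintro ζ (⟨α, β, hα, hβ, hαβ, rfl⟩ | ⟨α, β, hα, hβ, hαβ, rfl⟩)
    · obtain rfl : α = 1 - β := by linarith
      apply tendsto_modelGraph_top hA hB hm <;>
      simp only [Complex.add_im, Complex.smul_im, Complex.add_re, Complex.smul_re, smul_eq_mul] <;>
      generalize m * (Real.pi / 2) = H at hH
      · ring
      · have := mul_pos hB hH
        rw [abs_lt]
        constructor <;> nlinarith
    · obtain rfl : α = 1 - β := by linarith
      apply tendsto_modelGraph_bottom hA hB hm <;>
      simp only [Complex.add_im, Complex.smul_im, Complex.add_re, Complex.smul_re, smul_eq_mul] <;>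
      generalize m * (Real.pi / 2) = H at hH
      · ring
      · have := mul_pos hA hH
        rw [abs_lt]
        constructor <;> nlinarith

end ModelQuad

/-! ## The classical Scherk graph -/

theorem one_add_mul_cot_sq {a b : ℝ} (hb : b ∈ Ioo 0 (Real.pi / 2)) :
    1 + (Real.sinh a / Real.cosh a * (Real.cos b / Real.sin b)) ^ 2 =
      (Real.cosh (2 * a) - Real.cos (2 * b)) / (2 * (Real.cosh a * Real.sin b) ^ 2) := by
  have h1 := sin_pos_of_mem_row hb
  have h3 := Real.cosh_pos a
  rw [cosh_sub_cos_eq]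
  field_simp

theorem one_add_mul_tan_sq {a b : ℝ} (hb : b ∈ Ioo 0 (Real.pi / 2)) :
    1 + (Real.sinh a / Real.cosh a * (Real.sin b / Real.cos b)) ^ 2 =
      (Real.cosh (2 * a) + Real.cos (2 * b)) / (2 * (Real.cosh a * Real.cos b) ^ 2) := by
  have h1 := cos_pos_of_mem_row hb
  have h3 := Real.cosh_pos a
  rw [cosh_add_cos_eq]
  field_simp

theorem sqrt_div_two_mul_sq {x y : ℝ} (hx : 0 ≤ x) (hy : 0 < y) :
    Real.sqrt (x / (2 * y ^ 2)) = Real.sqrt x / (Real.sqrt 2 * y) := by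
  rw [Real.sqrt_div hx, Real.sqrt_mul (by norm_num), Real.sqrt_sq hy.le]

/-- The right side is |sinh 2w|. For A = B = 1/2 its logarithm is the height up to scale, and the
left side is the quotient of cosines in Scherk's formula. -/
theorem cos_arctan_add_arctan {a b : ℝ} (hb : b ∈ Ioo 0 (Real.pi / 2)) :
    Real.sin (2 * b) / Real.cos (Real.arctan (Real.sinh a / Real.cosh a * (Real.cos b / Real.sin b)) +
        Real.arctan (Real.sinh a / Real.cosh a * (Real.sin b / Real.cos b))) =
      Real.sqrt (Real.cosh (2 * a) - Real.cos (2 * b)) *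
        Real.sqrt (Real.cosh (2 * a) + Real.cos (2 * b)) := by
  have h1 := sin_pos_of_mem_row hb
  have h2 := cos_pos_of_mem_row hb
  have h3 := Real.cosh_pos a
  have hp := cosh_sub_cos_pos (a := a) hb
  have hq := cosh_add_cos_pos (a := a) hb
  have hp' := Real.sqrt_pos.2 hp
  have hq' := Real.sqrt_pos.2 hq
  rw [Real.cos_add, Real.cos_arctan, Real.cos_arctan, Real.sin_arctan, Real.sin_arctan,
    one_add_mul_cot_sq hb, one_add_mul_tan_sq hb, sqrt_div_two_mul_sq hp.le (by positivity),
    sqrt_div_two_mul_sq hq.le (by positivity), Real.sin_two_mul]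
  set P := Real.sqrt (Real.cosh (2 * a) - Real.cos (2 * b))
  set Q := Real.sqrt (Real.cosh (2 * a) + Real.cos (2 * b))
  have h22 : Real.sqrt 2 ^ 2 = 2 := Real.sq_sqrt (by norm_num)
  have key : 1 / (P / (Real.sqrt 2 * (Real.cosh a * Real.sin b))) *
      (1 / (Q / (Real.sqrt 2 * (Real.cosh a * Real.cos b)))) -
      Real.sinh a / Real.cosh a * (Real.cos b / Real.sin b) /
        (P / (Real.sqrt 2 * (Real.cosh a * Real.sin b))) *
      (Real.sinh a / Real.cosh a * (Real.sin b / Real.cos b) /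
        (Q / (Real.sqrt 2 * (Real.cosh a * Real.cos b)))) =
      2 * Real.sin b * Real.cos b / (P * Q) := by
    field_simp
    rw [h22]
    linear_combination 2 * Real.cosh_sq a
  rw [key]
  field_simp

theorem modelGraph_eq_scherk :
    EqOn (modelGraph (1 / 2) (1 / 2) (2 * Real.sqrt 2 / Real.pi) (-(Real.sqrt 2 / 2))) scherk
      (modelDomain (1 / 2) (1 / 2) (2 * Real.sqrt 2 / Real.pi) (-(Real.sqrt 2 / 2))) := by
  intro z hz
  have hA : (0 : ℝ) < 1 / 2 := by norm_num
  have hpi := Real.pi_pos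
  have h2 : 0 < Real.sqrt 2 := by positivity
  have h22 : Real.sqrt 2 ^ 2 = 2 := Real.sq_sqrt (by norm_num)
  have hm : 0 < 2 * Real.sqrt 2 / Real.pi := by positivity
  have hw := modelInv_mem hA hA hm hz
  have h := modelMap_modelInv hA hA hm hz
  unfold modelGraph
  set w := modelInv (1 / 2) (1 / 2) (2 * Real.sqrt 2 / Real.pi) (-(Real.sqrt 2 / 2)) z
  have hre := congrArg Complex.re h
  have him := congrArg Complex.im h
  simp only [modelMap, rowMap, modelAbscissa] at hre him
  have e1 : Real.pi * z.im / Real.sqrt 2 = 2 * w.im - Real.pi / 2 := by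
    rw [← him]
    field_simp
    ring
  have e2 : Real.pi * z.re / Real.sqrt 2 =
      Real.arctan (Real.sinh w.re / Real.cosh w.re * (Real.cos w.im / Real.sin w.im)) +
        Real.arctan (Real.sinh w.re / Real.cosh w.re * (Real.sin w.im / Real.cos w.im)) := by
    rw [← hre, rowAbscissa]
    field_simp
  unfold scherk modelHeight rowHeight
  rw [e1, e2, Real.cos_sub_pi_div_two, cos_arctan_add_arctan hw,
    Real.log_mul (Real.sqrt_pos.2 (cosh_sub_cos_pos hw)).ne'
      (Real.sqrt_pos.2 (cosh_add_cos_pos hw)).ne', Real.log_sqrt (cosh_sub_cos_pos hw).le,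
    Real.log_sqrt (cosh_add_cos_pos hw).le]
  ring

/-! ## The family of trapezoids -/

section Family

variable {t : ℝ}

/-- The coefficient `A` of the model surface over `trapezoid t`. -/
noncomputable def bottomCoeff (t : ℝ) : ℝ :=
  (Real.cos (t / 2) + Real.sqrt (Real.cos t)) / (2 * Real.sin (t / 2))

/-- The coefficient `B` of the model surface over `trapezoid t`. -/
noncomputable def topCoeff (t : ℝ) : ℝ :=
  (Real.cos (t / 2) - Real.sqrt (Real.cos t)) / (2 * Real.sin (t / 2))

/-- The scale `m` of the model surface over `trapezoid t`. -/
noncomputable def scaleCoeff (t : ℝ) : ℝ :=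
  4 * Real.sin (t / 2) ^ 2 / (Real.pi * Real.cos (t / 2))

/-- The ordinate of the lower base of `trapezoid t`. -/
noncomputable def bottomOrdinate (t : ℝ) : ℝ :=
  Real.sqrt (Real.cos t) - Real.sin (t / 2) ^ 2 / Real.cos (t / 2)

theorem sqrt_cos_lt_cos_half (ht : t ∈ Ioc 0 (Real.pi / 2)) :
    Real.sqrt (Real.cos t) < Real.cos (t / 2) := by
  rw [Real.sqrt_lt' (cos_half_pos ht), cos_half_sq]
  have := sin_half_sq t
  have := sin_half_pos ht
  nlinarith

theorem bottomCoeff_pos (ht : t ∈ Ioc 0 (Real.pi / 2)) : 0 < bottomCoeff t := by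
  have := sin_half_pos ht
  have := cos_half_pos ht
  unfold bottomCoeff
  positivity

theorem topCoeff_pos (ht : t ∈ Ioc 0 (Real.pi / 2)) : 0 < topCoeff t :=
  div_pos (sub_pos.2 (sqrt_cos_lt_cos_half ht)) (by have := sin_half_pos ht; positivity)

theorem scaleCoeff_pos (ht : t ∈ Ioc 0 (Real.pi / 2)) : 0 < scaleCoeff t := by
  have := sin_half_pos ht
  have := cos_half_pos ht
  have := Real.pi_pos
  unfold scaleCoeff
  positivity

/-- A difference of squares: cos²(t/2) - cos t = sin²(t/2). -/
theorem coeff_mul (ht : t ∈ Ioc 0 (Real.pi / 2)) : 4 * bottomCoeff t * topCoeff t = 1 := by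
  have h := sin_half_pos ht
  have h1 := Real.sq_sqrt (cos_nonneg_of_mem ht)
  have h2 := cos_half_sq t
  have h3 := sin_half_sq t
  unfold bottomCoeff topCoeff
  field_simp
  linear_combination 4 * h2 - 4 * h3 - 4 * h1

theorem cos_sAngle (ht : t ∈ Ioc 0 (Real.pi / 2)) :
    Real.cos (sAngle t) = (3 * Real.cos t - 1) / (1 + Real.cos t) := by
  have h := cos_nonneg_of_mem ht
  have h1 := Real.cos_le_one t
  unfold sAngle
  rw [Real.cos_arccos]
  · rw [le_div_iff₀ (by linarith)]; linarith
  · rw [div_le_one (by linarith)]; linarith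

/-- This is the Jenkins–Serrin balance: each leg has length 2 sin(t/2), while the bases add up to 4
sin(s/2) cos(t/2). -/
theorem sin_half_sAngle (ht : t ∈ Ioc 0 (Real.pi / 2)) :
    Real.sin (sAngle t / 2) = Real.sin (t / 2) / Real.cos (t / 2) := by
  have h := sin_half_pos ht
  have h1 := cos_half_pos ht
  have h2 := cos_nonneg_of_mem ht
  refine (sq_eq_sq₀ (Real.sin_nonneg_of_nonneg_of_le_pi
    (by have := Real.arccos_nonneg ((3 * Real.cos t - 1) / (1 + Real.cos t)); unfold sAngle; linarith)
    (by have := Real.arccos_le_pi ((3 * Real.cos t - 1) / (1 + Real.cos t)); unfold sAngle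
        linarith [Real.pi_pos])) (by positivity)).1 ?_
  rw [sin_half_sq, cos_sAngle ht, div_pow, sin_half_sq, cos_half_sq]
  field_simp
  ring

theorem cos_half_sAngle (ht : t ∈ Ioc 0 (Real.pi / 2)) :
    Real.cos (sAngle t / 2) = Real.sqrt (Real.cos t) / Real.cos (t / 2) := by
  have h1 := cos_half_pos ht
  have h2 := cos_nonneg_of_mem ht
  refine (sq_eq_sq₀ (Real.cos_nonneg_of_neg_pi_div_two_le_of_le
    (by have := Real.arccos_nonneg ((3 * Real.cos t - 1) / (1 + Real.cos t)); unfold sAngle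
        linarith [Real.pi_pos])
    (by have := Real.arccos_le_pi ((3 * Real.cos t - 1) / (1 + Real.cos t)); unfold sAngle
        linarith [Real.pi_pos])) (by positivity)).1 ?_
  rw [cos_half_sq, cos_sAngle ht, div_pow, Real.sq_sqrt h2, cos_half_sq]
  field_simp
  ring

theorem unitPt_eq (θ : ℝ) : unitPt θ = ⟨Real.cos θ, Real.sin θ⟩ := by
  apply Complex.ext
  · exact Complex.exp_ofReal_mul_I_re θ
  · exact Complex.exp_ofReal_mul_I_im θ

/-- Half the length of the lower base. Together with the next three identities it matches the
vertices on the circle with those of the model trapezoid. -/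
theorem sin_half_add (ht : t ∈ Ioc 0 (Real.pi / 2)) : Real.sin (t / 2 + sAngle t / 2) =
    bottomCoeff t * (scaleCoeff t * (Real.pi / 2)) := by
  have h := sin_half_pos ht
  have h1 := cos_half_pos ht
  have := Real.pi_pos
  rw [Real.sin_add, sin_half_sAngle ht, cos_half_sAngle ht, bottomCoeff, scaleCoeff]
  field_simp
  ring

theorem sin_half_sub (ht : t ∈ Ioc 0 (Real.pi / 2)) : Real.sin (sAngle t / 2 - t / 2) =
    topCoeff t * (scaleCoeff t * (Real.pi / 2)) := by
  have h := sin_half_pos ht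
  have h1 := cos_half_pos ht
  have := Real.pi_pos
  rw [Real.sin_sub, sin_half_sAngle ht, cos_half_sAngle ht, topCoeff, scaleCoeff]
  field_simp
  ring

theorem cos_half_add (ht : t ∈ Ioc 0 (Real.pi / 2)) : Real.cos (t / 2 + sAngle t / 2) =
    bottomOrdinate t := by
  have h1 := cos_half_pos ht
  rw [Real.cos_add, sin_half_sAngle ht, cos_half_sAngle ht, bottomOrdinate]
  field_simp

theorem cos_half_sub (ht : t ∈ Ioc 0 (Real.pi / 2)) : Real.cos (sAngle t / 2 - t / 2) =
    bottomOrdinate t + scaleCoeff t * (Real.pi / 2) := by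
  have h1 := cos_half_pos ht
  have := Real.pi_pos
  rw [Real.cos_sub, sin_half_sAngle ht, cos_half_sAngle ht, bottomOrdinate, scaleCoeff]
  field_simp
  ring

theorem unitPt_alphaAngle (ht : t ∈ Ioc 0 (Real.pi / 2)) : unitPt (alphaAngle t) =
    ⟨bottomCoeff t * (scaleCoeff t * (Real.pi / 2)), bottomOrdinate t⟩ := by
  rw [unitPt_eq, ← sin_half_add ht, ← cos_half_add ht,
    show alphaAngle t = Real.pi / 2 - (t / 2 + sAngle t / 2) by unfold alphaAngle tauAngle; ring,
    Real.cos_pi_div_two_sub, Real.sin_pi_div_two_sub]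

theorem unitPt_betaAngle (ht : t ∈ Ioc 0 (Real.pi / 2)) : unitPt (betaAngle t) =
    ⟨topCoeff t * (scaleCoeff t * (Real.pi / 2)),
      bottomOrdinate t + scaleCoeff t * (Real.pi / 2)⟩ := by
  rw [unitPt_eq, ← sin_half_sub ht, ← cos_half_sub ht,
    show betaAngle t = Real.pi / 2 - (sAngle t / 2 - t / 2) by unfold betaAngle tauAngle; ring,
    Real.cos_pi_div_two_sub, Real.sin_pi_div_two_sub]

theorem unitPt_gammaAngle (ht : t ∈ Ioc 0 (Real.pi / 2)) : unitPt (gammaAngle t) =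
    ⟨-(topCoeff t * (scaleCoeff t * (Real.pi / 2))),
      bottomOrdinate t + scaleCoeff t * (Real.pi / 2)⟩ := by
  rw [unitPt_eq, ← sin_half_sub ht, ← cos_half_sub ht,
    show gammaAngle t = (sAngle t / 2 - t / 2) + Real.pi / 2 by unfold gammaAngle tauAngle; ring,
    Real.cos_add_pi_div_two, Real.sin_add_pi_div_two]

theorem unitPt_deltaAngle (ht : t ∈ Ioc 0 (Real.pi / 2)) : unitPt (deltaAngle t) =
    ⟨-(bottomCoeff t * (scaleCoeff t * (Real.pi / 2))), bottomOrdinate t⟩ := by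
  rw [unitPt_eq, ← sin_half_add ht, ← cos_half_add ht,
    show deltaAngle t = (t / 2 + sAngle t / 2) + Real.pi / 2 by unfold deltaAngle tauAngle; ring,
    Real.cos_add_pi_div_two, Real.sin_add_pi_div_two]

theorem trapezoid_eq (ht : t ∈ Ioc 0 (Real.pi / 2)) : trapezoid t =
    modelDomain (bottomCoeff t) (topCoeff t) (scaleCoeff t) (bottomOrdinate t) := by
  rw [trapezoid, unitPt_alphaAngle ht, unitPt_betaAngle ht, unitPt_gammaAngle ht,
    unitPt_deltaAngle ht,
    quad_eq_modelDomain (bottomCoeff_pos ht) (topCoeff_pos ht) (scaleCoeff_pos ht)]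

/-- The Scherk type graph over `trapezoid t`. -/
noncomputable def scherkGraph (t : ℝ) : ℂ → ℝ :=
  modelGraph (bottomCoeff t) (topCoeff t) (scaleCoeff t) (bottomOrdinate t)

theorem isHorizontalIsoscelesTrapezoid_unitPt (ht : t ∈ Ioc 0 (Real.pi / 2)) :
    IsHorizontalIsoscelesTrapezoid (unitPt (alphaAngle t)) (unitPt (betaAngle t))
      (unitPt (gammaAngle t)) (unitPt (deltaAngle t)) := by
  have hA := bottomCoeff_pos ht
  have hB := topCoeff_pos ht
  have hm := scaleCoeff_pos ht
  have hH : 0 < scaleCoeff t * (Real.pi / 2) := by have := Real.pi_pos; positivity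
  rw [unitPt_alphaAngle ht, unitPt_betaAngle ht, unitPt_gammaAngle ht, unitPt_deltaAngle ht]
  generalize scaleCoeff t * (Real.pi / 2) = H at hH
  refine ⟨rfl, rfl, by simpa using hH.ne', ?_, ?_, ?_⟩
  · have := mul_pos (mul_pos hB hH) (mul_pos hA hH)
    simp only
    linarith
  · rw [Complex.norm_eq_sqrt_sq_add_sq, Complex.norm_eq_sqrt_sq_add_sq]
    simp only [Complex.sub_re, Complex.sub_im]
    congr 1
    ring
  · rw [Complex.norm_eq_sqrt_sq_add_sq, Complex.norm_eq_sqrt_sq_add_sq]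
    simp only [Complex.sub_re, Complex.sub_im]
    congr 1
    ring

theorem isScherkTypeGraph_scherkGraph (ht : t ∈ Ioc 0 (Real.pi / 2)) :
    IsScherkTypeGraph (unitPt (alphaAngle t)) (unitPt (betaAngle t))
      (unitPt (gammaAngle t)) (unitPt (deltaAngle t)) (scherkGraph t) := by
  rw [unitPt_alphaAngle ht, unitPt_betaAngle ht, unitPt_gammaAngle ht, unitPt_deltaAngle ht]
  exact isScherkTypeGraph_modelGraph (bottomCoeff_pos ht) (topCoeff_pos ht) (scaleCoeff_pos ht)
    (coeff_mul ht)

theorem zero_mem_trapezoid (ht : t ∈ Ioc tCirc (Real.pi / 2)) : (0 : ℂ) ∈ trapezoid t := by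
  have ht' := Ioc_tCirc_subset ht
  have h := sin_half_pos ht'
  have h1 := cos_half_pos ht'
  have hpi := Real.pi_pos
  -- Clearing denominators, this is the inequality φ < π/2.
  have hneg : bottomOrdinate t < 0 := by
    have := phiAngle_lt ht
    unfold phiAngle at this
    rw [div_lt_iff₀ (by positivity), mul_assoc] at this
    have h2 := lt_of_mul_lt_mul_left this (by positivity)
    unfold bottomOrdinate
    rw [sub_neg, lt_div_iff₀ h1]
    exact h2
  have hpos : 0 < bottomOrdinate t + scaleCoeff t * (Real.pi / 2) := by
    have : bottomOrdinate t + scaleCoeff t * (Real.pi / 2) =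
        Real.sqrt (Real.cos t) + Real.sin (t / 2) ^ 2 / Real.cos (t / 2) := by
      unfold bottomOrdinate scaleCoeff
      field_simp
      ring
    rw [this]
    positivity
  rw [trapezoid_eq ht']
  refine ⟨hneg, hpos, ?_⟩
  have e1 := mul_pos (bottomCoeff_pos ht') hpos
  have e2 := mul_pos (topCoeff_pos ht') (neg_pos.2 hneg)
  simp only [Complex.zero_re, Complex.zero_im, abs_zero]
  linarith

theorem gaussCurvature_scherkGraph (ht : t ∈ Ioc tCirc (Real.pi / 2)) :
    gaussCurvature (scherkGraph t) 0 = -(kappa t) ^ 2 := by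
  have ht' := Ioc_tCirc_subset ht
  have h := sin_half_pos ht'
  have h1 := cos_half_pos ht'
  have hpi := Real.pi_pos
  have h0 := zero_mem_trapezoid ht
  rw [trapezoid_eq ht'] at h0
  rw [scherkGraph, gaussCurvature_modelGraph_axis (bottomCoeff_pos ht') (topCoeff_pos ht')
    (scaleCoeff_pos ht') (coeff_mul ht') h0 Complex.zero_re, kappa_eq ht]
  -- The parameter 2b over the origin is complementary to φ, so its sine and cosine become cos φ and
  -- sin φ.
  have hangle : 2 * (((0 : ℂ).im - bottomOrdinate t) / scaleCoeff t) =
      Real.pi / 2 - phiAngle t := by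
    rw [Complex.zero_im]
    unfold bottomOrdinate scaleCoeff phiAngle
    field_simp
    ring
  rw [hangle, Real.sin_pi_div_two_sub, Real.cos_pi_div_two_sub]
  have hsin : 0 ≤ Real.sin (phiAngle t) :=
    Real.sin_nonneg_of_nonneg_of_le_pi (phiAngle_nonneg ht')
      (by linarith [phiAngle_lt ht, Real.pi_pos])
  have hE : bottomCoeff t + topCoeff t + (bottomCoeff t - topCoeff t) * Real.sin (phiAngle t) =
      (Real.cos (t / 2) + Real.sqrt (Real.cos t) * Real.sin (phiAngle t)) / Real.sin (t / 2) := by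
    unfold bottomCoeff topCoeff
    field_simp
    ring
  have hE' : Real.cos (t / 2) + Real.sqrt (Real.cos t) * Real.sin (phiAngle t) ≠ 0 := by
    positivity
  rw [hE, scaleCoeff]
  congr 2
  field_simp
  ring

theorem sin_pi_div_two_half : Real.sin (Real.pi / 2 / 2) = Real.sqrt 2 / 2 := by
  rw [show Real.pi / 2 / 2 = Real.pi / 4 by ring, Real.sin_pi_div_four]

theorem cos_pi_div_two_half : Real.cos (Real.pi / 2 / 2) = Real.sqrt 2 / 2 := by
  rw [show Real.pi / 2 / 2 = Real.pi / 4 by ring, Real.cos_pi_div_four]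

theorem bottomCoeff_pi_div_two : bottomCoeff (Real.pi / 2) = 1 / 2 := by
  unfold bottomCoeff
  rw [sin_pi_div_two_half, cos_pi_div_two_half, Real.cos_pi_div_two, Real.sqrt_zero]
  field_simp
  norm_num

theorem topCoeff_pi_div_two : topCoeff (Real.pi / 2) = 1 / 2 := by
  unfold topCoeff
  rw [sin_pi_div_two_half, cos_pi_div_two_half, Real.cos_pi_div_two, Real.sqrt_zero]
  field_simp
  norm_num

theorem scaleCoeff_pi_div_two : scaleCoeff (Real.pi / 2) = 2 * Real.sqrt 2 / Real.pi := by
  unfold scaleCoeff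
  rw [sin_pi_div_two_half, cos_pi_div_two_half]
  have := Real.pi_pos
  field_simp
  norm_num

theorem bottomOrdinate_pi_div_two : bottomOrdinate (Real.pi / 2) = -(Real.sqrt 2 / 2) := by
  unfold bottomOrdinate
  rw [sin_pi_div_two_half, cos_pi_div_two_half, Real.cos_pi_div_two, Real.sqrt_zero]
  field_simp
  norm_num

theorem pi_div_two_mem : Real.pi / 2 ∈ Ioc 0 (Real.pi / 2) :=
  ⟨by have := Real.pi_pos; positivity, le_rfl⟩

theorem trapezoid_pi_div_two : trapezoid (Real.pi / 2) =
    {z : ℂ | |z.re| < Real.sqrt 2 / 2 ∧ |z.im| < Real.sqrt 2 / 2} := by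
  rw [trapezoid_eq pi_div_two_mem, bottomCoeff_pi_div_two, topCoeff_pi_div_two,
    scaleCoeff_pi_div_two, bottomOrdinate_pi_div_two]
  have hpi := Real.pi_pos
  have e : 2 * Real.sqrt 2 / Real.pi * (Real.pi / 2) = Real.sqrt 2 := by field_simp
  ext z
  simp only [modelDomain, mem_ofPred_eq, e, abs_lt]
  constructor
  · rintro ⟨h1, h2, h3, h4⟩
    exact ⟨⟨by linarith, by linarith⟩, by linarith, by linarith⟩
  · rintro ⟨⟨h3, h4⟩, h1, h2⟩
    exact ⟨by linarith, by linarith, by linarith, by linarith⟩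

theorem scherkGraph_pi_div_two :
    EqOn (scherkGraph (Real.pi / 2)) scherk (trapezoid (Real.pi / 2)) := by
  rw [trapezoid_eq pi_div_two_mem, scherkGraph, bottomCoeff_pi_div_two, topCoeff_pi_div_two,
    scaleCoeff_pi_div_two, bottomOrdinate_pi_div_two]
  exact modelGraph_eq_scherk

theorem Du_scherkGraph_axis (ht : t ∈ Ioc 0 (Real.pi / 2)) {z : ℂ} (hz : z ∈ trapezoid t)
    (h0 : z.re = 0) : Du (scherkGraph t) z = 0 ∧ Dv (Du (scherkGraph t)) z = 0 := by
  rw [trapezoid_eq ht] at hz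
  exact Du_modelGraph_axis (bottomCoeff_pos ht) (topCoeff_pos ht) (scaleCoeff_pos ht) hz h0

end Family

theorem proposition4p1 :
    (∃ f : ℝ → ℂ → ℝ,
      (∀ t ∈ Ioc 0 (Real.pi / 2),
        IsHorizontalIsoscelesTrapezoid (unitPt (alphaAngle t)) (unitPt (betaAngle t))
          (unitPt (gammaAngle t)) (unitPt (deltaAngle t)) ∧
        IsScherkTypeGraph (unitPt (alphaAngle t)) (unitPt (betaAngle t))
          (unitPt (gammaAngle t)) (unitPt (deltaAngle t)) (f t) ∧
        ∀ z ∈ trapezoid t, z.re = 0 → Du (f t) z = 0 ∧ Dv (Du (f t)) z = 0) ∧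
      (∀ t ∈ Ioc tCirc (Real.pi / 2),
        (0 : ℂ) ∈ trapezoid t ∧
        Du (f t) 0 = 0 ∧ Dv (Du (f t)) 0 = 0 ∧
        gaussCurvature (f t) 0 = -(kappa t) ^ 2) ∧
      trapezoid (Real.pi / 2) =
        {z : ℂ | |z.re| < Real.sqrt 2 / 2 ∧ |z.im| < Real.sqrt 2 / 2} ∧
      EqOn (f (Real.pi / 2)) scherk (trapezoid (Real.pi / 2))) ∧
    (∀ t ∈ Ioc tCirc (Real.pi / 2), kappa t ^ 2 ≤ Real.pi ^ 2 / 2) ∧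
    Tendsto (fun t => kappa t ^ 2) (𝓝[>] tCirc) (𝓝 0) ∧
    IsIncreasingDiffeo (fun t => kappa t ^ 2) (Ioc tCirc (Real.pi / 2))
      (Ioc 0 (Real.pi ^ 2 / 2)) := by
  refine ⟨⟨scherkGraph, fun t ht => ⟨isHorizontalIsoscelesTrapezoid_unitPt ht,
    isScherkTypeGraph_scherkGraph ht, fun z hz h0 => Du_scherkGraph_axis ht hz h0⟩,
    fun t ht => ?_, trapezoid_pi_div_two, scherkGraph_pi_div_two⟩,
    fun t ht => (isIncreasingDiffeo_kappa_sq.2.1.mapsTo ht).2, tendsto_kappa_sq,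
    isIncreasingDiffeo_kappa_sq⟩
  have h0 := zero_mem_trapezoid ht
  have haxis := Du_scherkGraph_axis (Ioc_tCirc_subset ht) h0 Complex.zero_re
  exact ⟨h0, haxis.1, haxis.2, gaussCurvature_scherkGraph ht⟩
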